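/- For $\mathrm{Re}(s)>1$ let $\zeta(s)=\sum_{n\ge 1} n^{-s}$ and $\bar\zeta(s)=\sum_{n\ge 1}(-1)^{n-1}n^{-s}=(1-2^{1-s})\zeta(s)$, and let $\coth x=\cosh x/\sinh x$. Let $k$ be a positive integer. In all finite sums below the indices $k_1,k_2$ (resp. $k_1,k_2,k_3$) run over the positive integers with the stated sum. Then all the infinite series below converge absolutely, and the following four relations hold: (1) $$\sum_{n=1}^\infty\frac{\pi^2\coth^2(\pi n)}{n^{2k}}(-1)^n+2k(-1)^k\sum_{n=1}^\infty\frac{\pi}{n^{2k+1}\sinh(\pi n)}+(-1)^k\sum_{n=1}^\infty\frac{\pi^2\cosh(\pi n)}{n^{2k}\sinh^2(\pi n)}$$ $$+\zeta(2k+2)\left\{1-2^{-2k-1}-2(-1)^{k+1}\right\}+\sum_{k_1+k_2=k+1}\zeta(2k_1)\zeta(2k_2)\left\{2(-1)^{k+1}-4(-1)^{k_2}(1-2^{1-2k_1})\right\}$$ $$+4\sum_{k_1+k_2+k_3=k+1}(-1)^{k_1+k_2}(1-2^{1-2k_3})\zeta(2k_1)\zeta(2k_2)\zeta(2k_3)=0;$$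 (2) $$\sum_{n=1}^\infty\frac{\pi^2}{n^{2k}\sinh^2(\pi n)}(-1)^n+2k(-1)^k\sum_{n=1}^\infty\frac{\pi}{n^{2k+1}\sinh(\pi n)}+(-1)^k\sum_{n=1}^\infty\frac{\pi^2\cosh(\pi n)}{n^{2k}\sinh^2(\pi n)}$$ $$+\zeta(2k+2)(1-2^{-2k-1})\left(1+2(-1)^{k+1}\right)+2\sum_{k_1+k_2=k+1}(-1)^{k_2}\left((-1)^{k_1}+2\right)\bar\zeta(2k_1)\bar\zeta(2k_2)$$ $$+4\sum_{k_1+k_2+k_3=k+1}(-1)^{k_1+k_2}\bar\zeta(2k_1)\bar\zeta(2k_2)\bar\zeta(2k_3)=0;$$ (3) $$\left(1+(-1)^k\right)\sum_{n=1}^\infty\frac{\pi^2}{n^{2k}\sinh^2(\pi n)}+2k(-1)^k\sum_{n=1}^\infty\frac{\pi\coth(\pi n)}{n^{2k+1}}+\zeta(2k+2)\left\{2(1-2^{-2k-1})(-1)^{k+1}-1\right\}$$ $$+2\sum_{k_1+k_2=k+1}(-1)^{k_2}\left((1-2^{1-2k_1})(-1)^{k_1}-2\right)\zeta(2k_1)\bar\zeta(2k_2)-4\sum_{k_1+k_2+k_3=k+1}(-1)^{k_1+k_2}\bar\zeta(2k_1)\bar\zeta(2k_2)\zeta(2k_3)=0;$$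 (4) $$\sum_{n=1}^\infty\frac{\pi^2\coth^2(\pi n)}{n^{2k}}+(-1)^k\sum_{n=1}^\infty\frac{\pi^2}{n^{2k}\sinh^2(\pi n)}+2k(-1)^k\sum_{n=1}^\infty\frac{\pi\coth(\pi n)}{n^{2k+1}}+\zeta(2k+2)\left(2(-1)^k-1\right)$$ $$+2\sum_{k_1+k_2=k+1}\left((-1)^{k_1+k_2}+2(-1)^{k_2}\right)\zeta(2k_1)\zeta(2k_2)-4\sum_{k_1+k_2+k_3=k+1}(-1)^{k_1+k_2}\zeta(2k_1)\zeta(2k_2)\zeta(2k_3)=0.$$ -/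

import Mathlib

/-- The real hyperbolic cotangent `cosh x / sinh x` (meant for `x ≠ 0`). -/
noncomputable def realCoth (x : ℝ) : ℝ := Real.cosh x / Real.sinh x

/-- The alternating zeta function `∑_{n ≥ 1} (-1)^(n-1) / n^s`, in its half plane of absolute
convergence `Re s > 1`; below it is evaluated at even integers `s ≥ 2` only. -/
noncomputable def altZeta (s : ℂ) : ℂ :=
  ∑' n : ℕ+, (-1 : ℂ) ^ ((n : ℕ) - 1) / ((n : ℕ) : ℂ) ^ s

/-- The pairs `(k₁, k₂)` of positive integers with `k₁ + k₂ = m`. -/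
def posPairs (m : ℕ) : Finset (ℕ × ℕ) :=
  (Finset.Icc 1 m ×ˢ Finset.Icc 1 m).filter fun p => p.1 + p.2 = m

/-- The triples `(k₁, k₂, k₃)` of positive integers with `k₁ + k₂ + k₃ = m`. -/
def posTriples (m : ℕ) : Finset (ℕ × ℕ × ℕ) :=
  (Finset.Icc 1 m ×ˢ Finset.Icc 1 m ×ˢ Finset.Icc 1 m).filter
    fun p => p.1 + p.2.1 + p.2.2 = m

/-- The term `π² coth²(π n) / n^(2k)`. -/
noncomputable def cothSqTerm (k : ℕ) (n : ℕ+) : ℝ :=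
  Real.pi ^ 2 * realCoth (Real.pi * (n : ℕ)) ^ 2 / ((n : ℕ) : ℝ) ^ (2 * k)

/-- The term `π² / (n^(2k) sinh²(π n))`. -/
noncomputable def cschSqTerm (k : ℕ) (n : ℕ+) : ℝ :=
  Real.pi ^ 2 / (((n : ℕ) : ℝ) ^ (2 * k) * Real.sinh (Real.pi * (n : ℕ)) ^ 2)

/-- The term `π² cosh(π n) / (n^(2k) sinh²(π n))`. -/
noncomputable def coshCschSqTerm (k : ℕ) (n : ℕ+) : ℝ :=
  Real.pi ^ 2 * Real.cosh (Real.pi * (n : ℕ)) /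
    (((n : ℕ) : ℝ) ^ (2 * k) * Real.sinh (Real.pi * (n : ℕ)) ^ 2)

/-- The term `π / (n^(2k+1) sinh(π n))`. -/
noncomputable def cschTerm (k : ℕ) (n : ℕ+) : ℝ :=
  Real.pi / (((n : ℕ) : ℝ) ^ (2 * k + 1) * Real.sinh (Real.pi * (n : ℕ)))

/-- The term `π coth(π n) / n^(2k+1)`. -/
noncomputable def cothTerm (k : ℕ) (n : ℕ+) : ℝ :=
  Real.pi * realCoth (Real.pi * (n : ℕ)) / ((n : ℕ) : ℝ) ^ (2 * k + 1)

/-! Write `Z_s(j) = ∑ sⁿ/n^(2j)` for a sign `s = ±1`, so that `Z_1(j) = ζ(2j)` and `Z_{-1}(j)` is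
minus the alternating value. The four relations are the four choices of two signs `(s, t)` in
`main_relation`: `s` is attached to the index `k₃`, `t` to `k₁` and `k₂`.

The hyperbolic series enter through partial fractions: `π coth πx` and `π / sinh πx` are `simplePole
1 x` and `simplePole (-1) x`, and minus their derivatives are `doublePole 1 x` and `doublePole (-1)
x`. Summed against powers of `n`, these become double sums of rational functions of `x = m²` and `y
= n²`. `partial_fraction_identity` collapses the relevant combination to finitely many monomials in
`1/x` and `1/y`, which gives a relation involving `s` alone, with weighted products `Z_s(a) Z_1(b)`
on the right (`sum_doublePole_add`).

The triple sums carry no further analytic content. The convolution `∑_{a+b=M} Z_t(a) Z_t(b) = (M -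
1/2) Z_1(M) + Z_t(M)`, valid for `M ≥ 2`, reduces them to exactly those weighted products plus an
unweighted pair sum. The formula fails at `M = 1`, where the convolution is empty; its defect
produces the term in `Z_s(k)` that turns `csch²` into `coth²` when `t = 1` and vanishes when `t =
-1`.

The convolution and the products of pole sums both rest on `hasSum_pair`: a kernel that is a divided
difference in the squares of the indices sums to single series, because `∑_{l ≠ m} t^l/(l² - m²)`
has a closed form. -/

/-! ### Closed form of `∑_{l ≠ m} t^l/(l² - m²)` by telescoping. -/

lemma summable_pnat_one_div_sq : Summable (fun n : ℕ+ => 1 / ((n : ℕ) : ℝ) ^ 2) :=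
  (Real.summable_one_div_nat_pow.mpr one_lt_two).comp_injective PNat.coe_injective

lemma abs_pow_of_sq_eq_one {s : ℝ} (hs : s ^ 2 = 1) (n : ℕ) : |s ^ n| = 1 := by
  rcases sq_eq_one_iff.mp hs with h | h <;> simp [h]

lemma sum_range_sub_shift (d : ℕ → ℝ) (p N : ℕ) :
    ∑ i ∈ Finset.range N, (d i - d (i + p)) =
      ∑ i ∈ Finset.range p, d i - ∑ i ∈ Finset.range p, d (N + i) := by
  rw [Finset.sum_sub_distrib]
  have h1 := Finset.sum_range_add d N p
  have h2 := Finset.sum_range_add d p N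
  rw [add_comm p N] at h2
  simp only [add_comm p] at h2
  linarith

lemma tendsto_sum_range_sub_shift (d : ℕ → ℝ) (p : ℕ)
    (hd : Filter.Tendsto d Filter.atTop (nhds 0)) :
    Filter.Tendsto (fun N => ∑ i ∈ Finset.range N, (d i - d (i + p))) Filter.atTop
      (nhds (∑ i ∈ Finset.range p, d i)) := by
  simp only [sum_range_sub_shift]
  have h : Filter.Tendsto (fun N => ∑ i ∈ Finset.range p, d (N + i)) Filter.atTop
      (nhds (∑ i ∈ Finset.range p, (0 : ℝ))) :=
    tendsto_finsetSum _ fun i _ => hd.comp (Filter.tendsto_add_atTop_nat i)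
  simpa using h.const_sub (∑ i ∈ Finset.range p, d i)

/-- The odd function `j ↦ t ^ j / j` on the integers. -/
noncomputable def zpowDiv (t : ℝ) (j : ℤ) : ℝ := t ^ j / j

lemma zpowDiv_neg {t : ℝ} (ht : t ^ 2 = 1) (j : ℤ) : zpowDiv t (-j) = -zpowDiv t j := by
  have : t⁻¹ = t := by
    rcases sq_eq_one_iff.mp ht with h | h <;> simp [h]
  rw [zpowDiv, zpowDiv, zpow_neg, ← inv_zpow, this]
  push_cast
  rw [div_neg]

lemma tendsto_zpowDiv {t : ℝ} (ht : t ^ 2 = 1) (m : ℕ) :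
    Filter.Tendsto (fun i : ℕ => zpowDiv t ((i : ℤ) + 1 - m)) Filter.atTop (nhds 0) := by
  have h1 : Filter.Tendsto (fun i : ℕ => ((i : ℤ) + 1 - m : ℤ)) Filter.atTop Filter.atTop := by
    have : (fun i : ℕ => ((i : ℤ) + 1 - m : ℤ)) = fun i : ℕ => (i : ℤ) + (1 - m) := by
      ext i; ring
    rw [this]
    exact Filter.tendsto_atTop_add_const_right _ _ tendsto_natCast_atTop_atTop
  have h2 : Filter.Tendsto (fun i : ℕ => (((i : ℤ) + 1 - m : ℤ) : ℝ)⁻¹) Filter.atTop (nhds 0) :=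
    tendsto_inv_atTop_zero.comp (tendsto_intCast_atTop_atTop.comp h1)
  refine squeeze_zero_norm (fun i => ?_) (by simpa using h2.norm)
  rw [zpowDiv, norm_div, norm_zpow]
  have : ‖t‖ = 1 := by
    rcases sq_eq_one_iff.mp ht with h | h <;> simp [h]
  simp [this]

/-- The argument runs over `1 - m, …, m`; oddness cancels everything but the endpoint `m`, the value
at `0` being `0` by division by zero. -/
lemma sum_range_zpowDiv {t : ℝ} (ht : t ^ 2 = 1) (m : ℕ) (hm : 1 ≤ m) :
    ∑ i ∈ Finset.range (2 * m), zpowDiv t ((i : ℤ) + 1 - m) = t ^ m / m := by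
  obtain ⟨p, rfl⟩ := Nat.exists_eq_add_of_le' hm
  rw [show 2 * (p + 1) = (2 * p + 1) + 1 by ring, Finset.sum_range_succ]
  have h : ∑ i ∈ Finset.range (2 * p + 1), zpowDiv t ((i : ℤ) + 1 - ((p + 1 : ℕ) : ℤ)) = 0 := by
    have h1 := Finset.sum_range_reflect
      (fun i : ℕ => zpowDiv t ((i : ℤ) + 1 - ((p + 1 : ℕ) : ℤ))) (2 * p + 1)
    have h2 : ∑ i ∈ Finset.range (2 * p + 1),
        zpowDiv t (((2 * p + 1 - 1 - i : ℕ) : ℤ) + 1 - ((p + 1 : ℕ) : ℤ)) =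
        -∑ i ∈ Finset.range (2 * p + 1), zpowDiv t ((i : ℤ) + 1 - ((p + 1 : ℕ) : ℤ)) := by
      rw [← Finset.sum_neg_distrib]
      refine Finset.sum_congr rfl fun i hi => ?_
      rw [← zpowDiv_neg ht]
      congr 1
      have := Finset.mem_range.mp hi
      omega
    linarith
  rw [h, zero_add, zpowDiv]
  have : (((2 * p + 1 : ℕ) : ℤ) + 1 - ((p + 1 : ℕ) : ℤ)) = ((p + 1 : ℕ) : ℤ) := by push_cast; ring
  rw [this, zpow_natCast]
  simp

/-- Since `l + m ≥ |l - m|`. The majorant depends only on the difference, so row sums are bounded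
uniformly in `m`. On the diagonal both sides are `0`. -/
lemma one_div_abs_sq_sub_sq_le (m l : ℕ+) :
    1 / |((l : ℕ) : ℝ) ^ 2 - ((m : ℕ) : ℝ) ^ 2| ≤ 1 / (((l : ℕ) : ℤ) - (m : ℕ) : ℤ) ^ 2 := by
  push_cast
  have hl : (1 : ℝ) ≤ (l : ℕ) := by exact_mod_cast l.pos
  have hm : (1 : ℝ) ≤ (m : ℕ) := by exact_mod_cast m.pos
  rcases eq_or_ne l m with rfl | h
  · simp
  have hne : ((l : ℕ) : ℝ) - (m : ℕ) ≠ 0 := by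
    rw [sub_ne_zero]
    exact_mod_cast fun h' => h (PNat.coe_injective h')
  refine one_div_le_one_div_of_le (by positivity) ?_
  rw [sq_sub_sq, abs_mul, ← sq_abs (((l : ℕ) : ℝ) - (m : ℕ)), pow_two]
  refine mul_le_mul_of_nonneg_right ?_ (abs_nonneg _)
  rw [abs_of_pos (by linarith : (0 : ℝ) < (l : ℕ) + (m : ℕ)), abs_le]
  constructor <;> linarith

lemma injective_pnat_sub (m : ℕ+) :
    Function.Injective (fun l : ℕ+ => (((l : ℕ) : ℤ) - (m : ℕ) : ℤ)) := by
  intro a b h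
  apply PNat.coe_injective
  simp only at h
  omega

lemma summable_int_one_div_sq : Summable (fun j : ℤ => 1 / (j : ℝ) ^ 2) :=
  Real.summable_one_div_int_pow.mpr one_lt_two

lemma summable_one_div_abs_sq_sub_sq (m : ℕ+) :
    Summable (fun l : ℕ+ => 1 / |((l : ℕ) : ℝ) ^ 2 - ((m : ℕ) : ℝ) ^ 2|) :=
  Summable.of_nonneg_of_le (fun _ => by positivity) (one_div_abs_sq_sub_sq_le m)
    (summable_int_one_div_sq.comp_injective (injective_pnat_sub m))

lemma tsum_one_div_abs_sq_sub_sq_le (m : ℕ+) :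
    ∑' l : ℕ+, 1 / |((l : ℕ) : ℝ) ^ 2 - ((m : ℕ) : ℝ) ^ 2| ≤ ∑' j : ℤ, 1 / (j : ℝ) ^ 2 :=
  ((summable_one_div_abs_sq_sub_sq m).tsum_le_tsum (one_div_abs_sq_sub_sq_le m)
    (summable_int_one_div_sq.comp_injective (injective_pnat_sub m))).trans
    (tsum_comp_le_tsum_of_inj summable_int_one_div_sq (fun _ => by positivity)
      (injective_pnat_sub m))

/-- Partial fractions in `l`, using `t^(±m) = t^m`. At `l = m` the left side is `0` by convention,
while the first term on the right leaves `-t^m/(4m²)`; the conditional term cancels it. -/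
lemma pow_div_sq_sub_sq {t : ℝ} (ht : t ^ 2 = 1) (m l : ℕ+) :
    t ^ (l : ℕ) / (((l : ℕ) : ℝ) ^ 2 - ((m : ℕ) : ℝ) ^ 2) =
      t ^ (m : ℕ) / (2 * (m : ℕ)) * (zpowDiv t ((l : ℕ) - (m : ℕ)) - zpowDiv t ((l : ℕ) + (m : ℕ)))
        + if l = m then t ^ (m : ℕ) / (4 * ((m : ℕ) : ℝ) ^ 2) else 0 := by
  have hl : (1 : ℝ) ≤ (l : ℕ) := by exact_mod_cast l.pos
  have hm : (1 : ℝ) ≤ (m : ℕ) := by exact_mod_cast m.pos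
  have ht0 : t ≠ 0 := by rintro rfl; norm_num at ht
  have htm : (t ^ (m : ℕ)) * t ^ (m : ℕ) = 1 := by
    rw [← pow_add, ← two_mul, pow_mul, ht, one_pow]
  have hadd : t ^ (((l : ℕ) : ℤ) + (m : ℕ)) = t ^ (l : ℕ) * t ^ (m : ℕ) := by
    rw [zpow_add₀ ht0, zpow_natCast, zpow_natCast]
  rcases eq_or_ne l m with rfl | h
  · simp only [zpowDiv, hadd, htm, sub_self, div_zero, if_true]
    simp
    field_simp
    ring
  have hne : ((l : ℕ) : ℝ) - (m : ℕ) ≠ 0 := by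
    rw [sub_ne_zero]
    exact_mod_cast fun h' => h (PNat.coe_injective h')
  have hne2 : ((l : ℕ) : ℝ) + (m : ℕ) ≠ 0 := by positivity
  have hsub : t ^ (((l : ℕ) : ℤ) - (m : ℕ)) = t ^ (l : ℕ) * t ^ (m : ℕ) := by
    rw [zpow_sub₀ ht0, zpow_natCast, zpow_natCast, div_eq_iff (pow_ne_zero _ ht0), mul_assoc, htm,
      mul_one]
  simp only [zpowDiv, hadd, hsub, if_neg h, add_zero]
  push_cast
  rw [sq_sub_sq]
  field_simp
  linear_combination (-2 * (m : ℕ) : ℝ) * htm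

lemma hasSum_pow_div_sq_sub_sq {t : ℝ} (ht : t ^ 2 = 1) (m : ℕ+) :
    HasSum (fun l : ℕ+ => t ^ (l : ℕ) / (((l : ℕ) : ℝ) ^ 2 - ((m : ℕ) : ℝ) ^ 2))
      ((1 + t ^ (m : ℕ) / 2) / (2 * ((m : ℕ) : ℝ) ^ 2)) := by
  have hm0 : ((m : ℕ) : ℝ) ≠ 0 := by exact_mod_cast m.ne_zero
  have ht0 : t ≠ 0 := by rintro rfl; norm_num at ht
  have htm : (t ^ (m : ℕ)) * t ^ (m : ℕ) = 1 := by
    rw [← pow_add, ← two_mul, pow_mul, ht, one_pow]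
  have hsum : Summable (fun l : ℕ+ => t ^ (l : ℕ) / (((l : ℕ) : ℝ) ^ 2 - ((m : ℕ) : ℝ) ^ 2)) := by
    refine Summable.of_norm ((summable_one_div_abs_sq_sub_sq m).congr fun l => ?_)
    rw [Real.norm_eq_abs, abs_div, abs_pow_of_sq_eq_one ht]
  have hite : HasSum (fun l : ℕ+ => if l = m then t ^ (m : ℕ) / (4 * ((m : ℕ) : ℝ) ^ 2) else 0)
      (t ^ (m : ℕ) / (4 * ((m : ℕ) : ℝ) ^ 2)) := hasSum_ite_eq m _
  set G : ℕ+ → ℝ := fun l =>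
    t ^ (m : ℕ) / (2 * (m : ℕ)) * (zpowDiv t ((l : ℕ) - (m : ℕ)) - zpowDiv t ((l : ℕ) + (m : ℕ)))
    with hG
  have hGs : Summable G := by
    refine (hsum.sub hite.summable).congr fun l => ?_
    rw [pow_div_sq_sub_sq ht, hG]
    ring
  have hG2 : HasSum G (t ^ (m : ℕ) / (2 * (m : ℕ)) * (t ^ (m : ℕ) / (m : ℕ))) := by
    rw [← Equiv.pnatEquivNat.symm.hasSum_iff, Summable.hasSum_iff_tendsto_nat
      (Equiv.pnatEquivNat.symm.summable_iff.mpr hGs)]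
    -- With `l = i + 1`, the arguments `l - m` and `l + m` differ by the shift `2m`, so the partial
    -- sums telescope to the first `2m` values.
    rw [← sum_range_zpowDiv ht m m.pos]
    refine ((tendsto_sum_range_sub_shift _ (2 * (m : ℕ)) (tendsto_zpowDiv ht m)).const_mul
      (t ^ (m : ℕ) / (2 * (m : ℕ)))).congr fun N => ?_
    rw [Finset.mul_sum]
    refine Finset.sum_congr rfl fun i _ => ?_
    simp only [hG, Function.comp, Equiv.pnatEquivNat_symm_apply, Nat.succPNat_coe]
    congr 3
    · push_cast; ring
  convert hG2.add hite using 1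
  · ext l
    rw [pow_div_sq_sub_sq ht]
  · field_simp
    linear_combination (-8 : ℝ) * htm

/-! ### Double sums of divided differences. -/

lemma summable_offDiag {s t : ℝ} (hs : s ^ 2 = 1) (ht : t ^ 2 = 1) (φ : ℕ+ → ℝ)
    (hφ : Summable fun m => |φ m|) :
    Summable (fun p : ℕ+ × ℕ+ => s ^ (p.1 : ℕ) * φ p.1 *
      (t ^ (p.2 : ℕ) / (((p.2 : ℕ) : ℝ) ^ 2 - ((p.1 : ℕ) : ℝ) ^ 2))) := by
  have hK : Summable fun m : ℕ+ => |φ m| *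
      ∑' l : ℕ+, 1 / |((l : ℕ) : ℝ) ^ 2 - ((m : ℕ) : ℝ) ^ 2| :=
    Summable.of_nonneg_of_le
      (fun m => mul_nonneg (abs_nonneg _) (tsum_nonneg fun _ => by positivity))
      (fun m => mul_le_mul_of_nonneg_left (tsum_one_div_abs_sq_sub_sq_le m) (abs_nonneg _))
      (hφ.mul_right _)
  let F : ℕ+ × ℕ+ → ℝ := fun p => |φ p.1| *
      (1 / |((p.2 : ℕ) : ℝ) ^ 2 - ((p.1 : ℕ) : ℝ) ^ 2|)
  have hF : 0 ≤ F := fun p => mul_nonneg (abs_nonneg _) (by positivity)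
  have key : Summable F := by
    refine (summable_prod_of_nonneg hF).mpr
      ⟨fun m => (summable_one_div_abs_sq_sub_sq m).mul_left |φ m|, ?_⟩
    exact hK.congr fun m => tsum_mul_left.symm
  refine Summable.of_norm (key.congr fun p => ?_)
  rw [Real.norm_eq_abs, abs_mul, abs_mul, abs_div, abs_pow_of_sq_eq_one hs,
    abs_pow_of_sq_eq_one ht, one_mul]

lemma hasSum_offDiag_fiber {s t : ℝ} (hs : s ^ 2 = 1) (ht : t ^ 2 = 1) (φ : ℕ+ → ℝ)
    (hφ : Summable fun m => |φ m|) :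
    HasSum (fun m : ℕ+ => s ^ (m : ℕ) * φ m * ((1 + t ^ (m : ℕ) / 2) / (2 * ((m : ℕ) : ℝ) ^ 2)))
      (∑' p : ℕ+ × ℕ+, s ^ (p.1 : ℕ) * φ p.1 *
        (t ^ (p.2 : ℕ) / (((p.2 : ℕ) : ℝ) ^ 2 - ((p.1 : ℕ) : ℝ) ^ 2))) :=
  HasSum.prod_fiberwise (summable_offDiag hs ht φ hφ).hasSum
    (fun m => (hasSum_pow_div_sq_sub_sq ht m).mul_left (s ^ (m : ℕ) * φ m))

lemma hasSum_offDiag_left {s t : ℝ} (hs : s ^ 2 = 1) (ht : t ^ 2 = 1) (φ : ℕ+ → ℝ)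
    (hφ : Summable fun m => |φ m|) :
    HasSum (fun p : ℕ+ × ℕ+ => s ^ (p.1 : ℕ) * φ p.1 *
      (t ^ (p.2 : ℕ) / (((p.2 : ℕ) : ℝ) ^ 2 - ((p.1 : ℕ) : ℝ) ^ 2)))
      (∑' m : ℕ+, s ^ (m : ℕ) * φ m * ((1 + t ^ (m : ℕ) / 2) / (2 * ((m : ℕ) : ℝ) ^ 2))) := by
  rw [(hasSum_offDiag_fiber hs ht φ hφ).tsum_eq]
  exact (summable_offDiag hs ht φ hφ).hasSum

/-- The off-diagonal part of a double sum whose terms are divided differences in the squares of the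
indices reduces to a single sum. -/
theorem hasSum_offDiag {s t : ℝ} (hs : s ^ 2 = 1) (ht : t ^ 2 = 1) (φ : ℕ+ → ℝ)
    (hφ : Summable fun m => |φ m|) :
    HasSum (fun p : ℕ+ × ℕ+ => s ^ (p.1 : ℕ) * t ^ (p.2 : ℕ) *
      ((φ p.1 - φ p.2) / (((p.2 : ℕ) : ℝ) ^ 2 - ((p.1 : ℕ) : ℝ) ^ 2)))
      (∑' m : ℕ+, (s ^ (m : ℕ) + t ^ (m : ℕ) + (s * t) ^ (m : ℕ)) *
        (φ m / (2 * ((m : ℕ) : ℝ) ^ 2))) := by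
  -- Each half of the numerator is absolutely summable on its own; the half with `φ l` is the other
  -- one with the indices and the signs exchanged.
  have h1 := hasSum_offDiag_left hs ht φ hφ
  have h2 := (Equiv.prodComm ℕ+ ℕ+).hasSum_iff.mpr (hasSum_offDiag_left ht hs φ hφ)
  convert h1.add h2 using 1
  · ext ⟨m, l⟩
    simp only [Function.comp, Equiv.prodComm_apply, Prod.swap]
    rw [← neg_sub (((l : ℕ) : ℝ) ^ 2) (((m : ℕ) : ℝ) ^ 2), div_neg]
    ring
  · rw [← (hasSum_offDiag_fiber hs ht φ hφ).summable.tsum_add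
      (hasSum_offDiag_fiber ht hs φ hφ).summable]
    refine tsum_congr fun m => ?_
    rw [mul_pow]
    ring

/-! ### Sign zeta values, pole sums and their products. -/

/-- `∑ sⁿ / n^(2j)`; for `s = 1` this is `ζ(2j)` and for `s = -1` it is the negative of the
alternating zeta value. -/
noncomputable def signZeta (s : ℝ) (j : ℕ) : ℝ :=
  ∑' n : ℕ+, s ^ (n : ℕ) * (1 / ((n : ℕ) : ℝ) ^ (2 * j))

/-- `∑ sⁿ / (x + n²)`. -/
noncomputable def poleSum (s x : ℝ) : ℝ :=
  ∑' n : ℕ+, s ^ (n : ℕ) * (1 / (x + ((n : ℕ) : ℝ) ^ 2))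

/-- `∑ sⁿ / (x + n²)²`. -/
noncomputable def poleSqSum (s x : ℝ) : ℝ :=
  ∑' n : ℕ+, s ^ (n : ℕ) * (1 / (x + ((n : ℕ) : ℝ) ^ 2) ^ 2)

lemma summable_of_le_one_div_sq {f : ℕ+ → ℝ} (h0 : ∀ n, 0 ≤ f n)
    (h : ∀ n, f n ≤ 1 / ((n : ℕ) : ℝ) ^ 2) : Summable f :=
  Summable.of_nonneg_of_le h0 h summable_pnat_one_div_sq

lemma summable_abs_of_nonneg {f : ℕ+ → ℝ} (h0 : ∀ n, 0 ≤ f n) (h : Summable f) :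
    Summable fun n => |f n| :=
  h.congr fun n => (abs_of_nonneg (h0 n)).symm

lemma summable_abs_pow_mul {s : ℝ} (hs : s ^ 2 = 1) {f : ℕ+ → ℝ} (h : Summable fun n => |f n|) :
    Summable fun n : ℕ+ => |s ^ (n : ℕ) * f n| :=
  h.congr fun n => by rw [abs_mul, abs_pow_of_sq_eq_one hs, one_mul]

lemma summable_pow_mul {s : ℝ} (hs : s ^ 2 = 1) {f : ℕ+ → ℝ} (h : Summable fun n => |f n|) :
    Summable fun n : ℕ+ => s ^ (n : ℕ) * f n :=
  summable_abs_iff.mp (summable_abs_pow_mul hs h)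

lemma one_le_pnat_cast (n : ℕ+) : (1 : ℝ) ≤ ((n : ℕ) : ℝ) := by exact_mod_cast n.pos

lemma summable_abs_one_div_pow {j : ℕ} (hj : 1 ≤ j) :
    Summable fun n : ℕ+ => |1 / ((n : ℕ) : ℝ) ^ (2 * j)| :=
  summable_abs_of_nonneg (fun _ => by positivity) <| summable_of_le_one_div_sq
    (fun _ => by positivity) fun n => one_div_le_one_div_of_le
      (pow_pos (by linarith [one_le_pnat_cast n]) _)
      (pow_le_pow_right₀ (one_le_pnat_cast n) (by omega))

lemma summable_abs_one_div_add {x : ℝ} (hx : 0 ≤ x) :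
    Summable fun n : ℕ+ => |1 / (x + ((n : ℕ) : ℝ) ^ 2)| :=
  summable_abs_of_nonneg (fun _ => by positivity) <| summable_of_le_one_div_sq
    (fun _ => by positivity) fun n => one_div_le_one_div_of_le
      (pow_pos (by linarith [one_le_pnat_cast n]) _) (by linarith)

lemma summable_abs_one_div_add_sq {x : ℝ} (hx : 0 ≤ x) :
    Summable fun n : ℕ+ => |1 / (x + ((n : ℕ) : ℝ) ^ 2) ^ 2| :=
  summable_abs_of_nonneg (fun _ => by positivity) <| summable_of_le_one_div_sq
    (fun _ => by positivity) fun n => one_div_le_one_div_of_le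
      (pow_pos (by linarith [one_le_pnat_cast n]) _) (by
        have h1 := one_le_pnat_cast n
        have h2 : (1 : ℝ) ≤ ((n : ℕ) : ℝ) ^ 2 := one_le_pow₀ h1
        nlinarith)

/-- A double sum with divided differences off the diagonal. -/
theorem hasSum_pair {s t : ℝ} (hs : s ^ 2 = 1) (ht : t ^ 2 = 1) {φ d : ℕ+ → ℝ}
    {K : ℕ+ → ℕ+ → ℝ} (hφ : Summable fun m => |φ m|) (hd : Summable fun m => |d m|)
    (hK : ∀ m l, m ≠ l →
      K m l = (φ m - φ l) / (((l : ℕ) : ℝ) ^ 2 - ((m : ℕ) : ℝ) ^ 2))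
    (hKd : ∀ m, K m m = d m) :
    HasSum (fun p : ℕ+ × ℕ+ => s ^ (p.1 : ℕ) * t ^ (p.2 : ℕ) * K p.1 p.2)
      ((∑' m : ℕ+, (s * t) ^ (m : ℕ) * d m) +
        ∑' m : ℕ+, (s ^ (m : ℕ) + t ^ (m : ℕ) + (s * t) ^ (m : ℕ)) *
          (φ m / (2 * ((m : ℕ) : ℝ) ^ 2))) := by
  have hst : (s * t) ^ 2 = 1 := by rw [mul_pow, hs, ht, one_mul]
  -- The divided difference is `0` on the diagonal by convention, so the true diagonal values are
  -- added as a separate family.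
  have hdiag : HasSum (fun p : ℕ+ × ℕ+ => if p.1 = p.2 then (s * t) ^ (p.1 : ℕ) * d p.1 else 0)
      (∑' m : ℕ+, (s * t) ^ (m : ℕ) * d m) := by
    have hinj : Function.Injective (fun m : ℕ+ => (m, m)) := fun a b h => (Prod.ext_iff.mp h).1
    rw [← hinj.hasSum_iff]
    · simpa [Function.comp_def] using (summable_pow_mul hst hd).hasSum
    · rintro ⟨a, b⟩ hab
      refine if_neg fun h => hab ⟨a, ?_⟩
      simp only at h
      rw [h]
  convert hdiag.add (hasSum_offDiag hs ht φ hφ) using 1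
  ext ⟨m, l⟩
  simp only
  split_ifs with h
  · subst h
    rw [hKd, sub_self, zero_div, mul_zero, add_zero, mul_pow]
  · rw [hK m l h, zero_add]

lemma tsum_pair_mul {s t : ℝ} (hs : s ^ 2 = 1) (ht : t ^ 2 = 1) {f g : ℕ+ → ℝ}
    (hf : Summable fun m => |f m|) (hg : Summable fun m => |g m|) :
    HasSum (fun p : ℕ+ × ℕ+ => s ^ (p.1 : ℕ) * t ^ (p.2 : ℕ) * (f p.1 * g p.2))
      ((∑' m : ℕ+, s ^ (m : ℕ) * f m) * ∑' m : ℕ+, t ^ (m : ℕ) * g m) := by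
  let F : ℕ+ → ℝ := fun m => s ^ (m : ℕ) * f m
  let G : ℕ+ → ℝ := fun m => t ^ (m : ℕ) * g m
  have h1 : Summable fun m => ‖F m‖ := summable_abs_pow_mul hs hf
  have h2 : Summable fun m => ‖G m‖ := summable_abs_pow_mul ht hg
  have h3 := (summable_mul_of_summable_norm h1 h2).hasSum
  rw [← tsum_mul_tsum_of_summable_norm h1 h2] at h3
  have h4 : (fun p : ℕ+ × ℕ+ => s ^ (p.1 : ℕ) * t ^ (p.2 : ℕ) * (f p.1 * g p.2)) =
      fun p => F p.1 * G p.2 := by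
    ext p
    simp only [F, G]
    ring
  rw [h4]
  exact h3

lemma sq_cast_sub_ne {m l : ℕ+} (h : m ≠ l) :
    ((l : ℕ) : ℝ) ^ 2 - ((m : ℕ) : ℝ) ^ 2 ≠ 0 := by
  rw [sub_ne_zero]
  intro h'
  have := (pow_left_inj₀ (by positivity) (by positivity) two_ne_zero).mp h'
  exact h (PNat.coe_injective (by exact_mod_cast this.symm))

/-- With `φ(m) = 1/(x + m²)`, the product `φ(m) φ(l)` is itself the divided difference of `φ`, and
`φ(m)/m² = (1/m² - φ(m))/x` resolves the single sums. -/
theorem poleSum_mul_poleSum {s t : ℝ} (hs : s ^ 2 = 1) (ht : t ^ 2 = 1) {x : ℝ} (hx : 0 < x) :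
    poleSum s x * poleSum t x = poleSqSum (s * t) x +
      1 / (2 * x) * ((signZeta s 1 - poleSum s x) + (signZeta t 1 - poleSum t x) +
        (signZeta (s * t) 1 - poleSum (s * t) x)) := by
  have hst : (s * t) ^ 2 = 1 := by rw [mul_pow, hs, ht, one_mul]
  have hb := summable_abs_one_div_add hx.le
  have h1 := tsum_pair_mul hs ht hb hb
  have h2 := hasSum_pair hs ht hb (summable_abs_one_div_add_sq hx.le)
    (K := fun m l => 1 / (x + ((m : ℕ) : ℝ) ^ 2) * (1 / (x + ((l : ℕ) : ℝ) ^ 2)))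
    (fun m l h => by
      have := sq_cast_sub_ne h
      have h1 : x + ((m : ℕ) : ℝ) ^ 2 ≠ 0 := by positivity
      have h2 : x + ((l : ℕ) : ℝ) ^ 2 ≠ 0 := by positivity
      field_simp
      ring)
    (fun m => by rw [← pow_two, div_pow, one_pow])
  have hZ : ∀ {u : ℝ}, u ^ 2 = 1 → HasSum (fun m : ℕ+ => u ^ (m : ℕ) *
      (1 / ((m : ℕ) : ℝ) ^ (2 * 1) - 1 / (x + ((m : ℕ) : ℝ) ^ 2)))
      (signZeta u 1 - poleSum u x) := fun {u} hu => by
    simp only [mul_sub]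
    exact (summable_pow_mul hu (summable_abs_one_div_pow le_rfl)).hasSum.sub
      (summable_pow_mul hu hb).hasSum
  have h3 := (((hZ hs).add (hZ ht)).add (hZ hst)).mul_left (1 / (2 * x))
  rw [poleSum, poleSum, h1.unique h2, poleSqSum, ← poleSum, ← poleSum, ← h3.tsum_eq]
  congr 1
  refine tsum_congr fun m => ?_
  have h1 : x + ((m : ℕ) : ℝ) ^ 2 ≠ 0 := by positivity
  have h2 : ((m : ℕ) : ℝ) ≠ 0 := by positivity
  field_simp
  ring

/-- For fixed `m ≠ l` the convolution is a two-variable geometric sum in `1/m²` and `1/l²`, that is,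
a divided difference of `1/m^(2(M+1))`; on the diagonal all `M + 1` terms agree. -/
theorem sum_antidiagonal_signZeta_mul {s t : ℝ} (hs : s ^ 2 = 1) (ht : t ^ 2 = 1) (M : ℕ) :
    ∑ p ∈ Finset.HasAntidiagonal.antidiagonal M, signZeta s (p.1 + 1) * signZeta t (p.2 + 1) =
      (M + 1) * signZeta (s * t) (M + 2) +
        (signZeta s (M + 2) + signZeta t (M + 2) + signZeta (s * t) (M + 2)) / 2 := by
  have hst : (s * t) ^ 2 = 1 := by rw [mul_pow, hs, ht, one_mul]
  have h1 := hasSum_sum (s := Finset.HasAntidiagonal.antidiagonal M) fun p _ => tsum_pair_mul hs ht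
    (summable_abs_one_div_pow (Nat.le_add_left 1 p.1))
    (summable_abs_one_div_pow (Nat.le_add_left 1 p.2))
  simp only [← Finset.mul_sum] at h1
  have h2 := hasSum_pair hs ht (summable_abs_one_div_pow (Nat.le_add_left 1 M))
    (d := fun m => (M + 1) * (1 / ((m : ℕ) : ℝ) ^ (2 * (M + 2))))
    (K := fun m l => ∑ p ∈ Finset.HasAntidiagonal.antidiagonal M,
      1 / ((m : ℕ) : ℝ) ^ (2 * (p.1 + 1)) * (1 / ((l : ℕ) : ℝ) ^ (2 * (p.2 + 1))))
    (by
      simp only [abs_mul]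
      exact (summable_abs_one_div_pow (by omega)).mul_left _)
    (fun m l h => by
      have hd := sq_cast_sub_ne h
      have h1 : ((m : ℕ) : ℝ) ≠ 0 := by positivity
      have h2 : ((l : ℕ) : ℝ) ≠ 0 := by positivity
      have hg := (Commute.all ((1 / ((m : ℕ) : ℝ)) ^ 2) ((1 / ((l : ℕ) : ℝ)) ^ 2)).mul_geom_sum₂ (M + 1)
      rw [Finset.Nat.sum_antidiagonal_eq_sum_range_succ_mk]
      rw [eq_div_iff hd]
      simp only [pow_mul, ← one_div_pow] 
      rw [← hg]
      simp only [Finset.mul_sum, Finset.sum_mul]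
      refine Finset.sum_congr rfl fun i hi => ?_
      rw [Nat.add_sub_cancel, pow_succ ((1 / ((m : ℕ) : ℝ)) ^ 2) i,
        pow_succ ((1 / ((l : ℕ) : ℝ)) ^ 2) (M - i)]
      generalize ((1 / ((l : ℕ) : ℝ)) ^ 2) ^ (M - i) = u
      generalize ((1 / ((m : ℕ) : ℝ)) ^ 2) ^ i = v
      field_simp)
    (fun m => by
      have h1 : ((m : ℕ) : ℝ) ≠ 0 := by positivity
      rw [Finset.sum_congr rfl (g := fun _ => 1 / ((m : ℕ) : ℝ) ^ (2 * (M + 2)))]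
      · simp
      · intro p hp
        rw [← Finset.HasAntidiagonal.mem_antidiagonal.mp hp]
        field_simp
        ring)
  have hZ : ∀ {u : ℝ}, u ^ 2 = 1 → HasSum (fun m : ℕ+ => u ^ (m : ℕ) *
      (1 / ((m : ℕ) : ℝ) ^ (2 * (M + 2)))) (signZeta u (M + 2)) := fun {u} hu =>
    (summable_pow_mul hu (summable_abs_one_div_pow (by omega))).hasSum
  have h3 := (((hZ hs).add (hZ ht)).add (hZ hst)).div_const 2
  have h4 := h1.unique h2
  change ∑ p ∈ Finset.HasAntidiagonal.antidiagonal M, signZeta s (p.1 + 1) * signZeta t (p.2 + 1) =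
    _ at h4
  rw [h4, ← h3.tsum_eq, signZeta, ← tsum_mul_left]
  congr 1
  · refine tsum_congr fun m => ?_
    ring
  · refine tsum_congr fun m => ?_
    have h2 : ((m : ℕ) : ℝ) ≠ 0 := by positivity
    field_simp
    ring

/-! ### Partial fractions of the hyperbolic functions. -/

/-- The Mittag-Leffler series of the cotangent at the imaginary point `ix`. -/
lemma realCoth_eq_poleSum {x : ℝ} (hx : 0 < x) :
    Real.pi * realCoth (Real.pi * x) = 1 / x + 2 * x * poleSum 1 (x ^ 2) := by
  have hz : (x * Complex.I : ℂ) ∈ Complex.integerComplement := by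
    rintro ⟨n, hn⟩
    have := congrArg Complex.im hn
    simp at this
    exact hx.ne this
  have h := cot_series_rep hz
  have hx0 : (x : ℂ) ≠ 0 := by exact_mod_cast hx.ne'
  have h1 : ∀ n : ℕ+, (1 / (x * Complex.I - (n : ℂ)) + 1 / (x * Complex.I + (n : ℂ))) =
      (-Complex.I * (2 * x)) * ((1 / (x ^ 2 + ((n : ℕ) : ℝ) ^ 2) : ℝ) : ℂ) := by
    intro n
    have h0 : ((x ^ 2 + ((n : ℕ) : ℝ) ^ 2 : ℝ) : ℂ) ≠ 0 := by
      exact_mod_cast (by positivity : (x ^ 2 + ((n : ℕ) : ℝ) ^ 2) ≠ 0)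
    push_cast at h0 ⊢
    have hmul : (x * Complex.I - ((n : ℕ) : ℂ)) * (x * Complex.I + ((n : ℕ) : ℂ)) =
        -((x : ℂ) ^ 2 + ((n : ℕ) : ℂ) ^ 2) := by
      linear_combination (x : ℂ) ^ 2 * Complex.I_sq
    have h2 : (x * Complex.I - ((n : ℕ) : ℂ)) ≠ 0 := fun h => h0 (by
      rw [h, zero_mul] at hmul; linear_combination hmul)
    have h3 : (x * Complex.I + ((n : ℕ) : ℂ)) ≠ 0 := fun h => h0 (by
      rw [h, mul_zero] at hmul; linear_combination hmul)
    rw [div_add_div _ _ h2 h3, hmul]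
    field_simp
    ring
  simp only [h1] at h
  rw [tsum_mul_left, ← Complex.ofReal_tsum] at h
  have h4 : (∑' n : ℕ+, 1 / (x ^ 2 + ((n : ℕ) : ℝ) ^ 2)) = poleSum 1 (x ^ 2) := by
    simp [poleSum]
  rw [h4, Complex.cot, show (Real.pi : ℂ) * (x * Complex.I) = ((Real.pi * x : ℝ) : ℂ) * Complex.I by
    push_cast; ring, Complex.cos_mul_I, Complex.sin_mul_I, ← Complex.ofReal_cosh,
    ← Complex.ofReal_sinh] at h
  have hs : ((Real.sinh (Real.pi * x) : ℝ) : ℂ) ≠ 0 := by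
    exact_mod_cast (Real.sinh_pos_iff.mpr (by positivity)).ne'
  have hI := Complex.I_ne_zero
  apply Complex.ofReal_injective
  rw [realCoth]
  push_cast
  have h5 : (Real.pi : ℂ) * (((Real.cosh (Real.pi * x) : ℝ) : ℂ) /
      (((Real.sinh (Real.pi * x) : ℝ) : ℂ) * Complex.I)) =
      -Complex.I * (Real.pi * (((Real.cosh (Real.pi * x) : ℝ) : ℂ) /
      ((Real.sinh (Real.pi * x) : ℝ) : ℂ))) := by
    field_simp
    rw [Complex.I_sq]; ring
  have h6 : (1 : ℂ) / (x * Complex.I) = -Complex.I * (1 / x) := by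
    field_simp
    rw [Complex.I_sq]; ring
  rw [h5, h6] at h
  have h7 : -Complex.I ≠ 0 := neg_ne_zero.mpr hI
  apply mul_left_cancel₀ h7
  push_cast at h
  rw [h]
  ring

lemma tsum_neg_one_pow_mul {F : ℕ+ → ℝ} (hF : Summable fun n => |F n|) :
    ∑' n : ℕ+, (-1 : ℝ) ^ (n : ℕ) * F n = 2 * ∑' n : ℕ+, F (2 * n) - ∑' n : ℕ+, F n := by
  have hF' : Summable F := summable_abs_iff.mp hF
  have hinj : Function.Injective (fun n : ℕ+ => 2 * n) := mul_right_injective 2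
  have h1 : HasSum (fun n : ℕ+ => (1 + (-1 : ℝ) ^ (n : ℕ)) * F n) (2 * ∑' n : ℕ+, F (2 * n)) := by
    rw [← hinj.hasSum_iff]
    · have h2 := ((hF'.comp_injective hinj).hasSum).mul_left 2
      have h4 : ((fun n : ℕ+ => (1 + (-1 : ℝ) ^ (n : ℕ)) * F n) ∘ fun n => 2 * n) =
          fun i => 2 * (F ∘ fun n => 2 * n) i := by
        funext n
        simp only [Function.comp, PNat.mul_coe]
        rw [show ((2 : ℕ+) : ℕ) = 2 from rfl, pow_mul, neg_one_sq, one_pow]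
        ring
      rw [h4]
      exact h2
    · intro n hn
      have : Odd (n : ℕ) := by
        rw [← Nat.not_even_iff_odd]
        rintro ⟨r, hr⟩
        have hr0 : 0 < r := by have := n.pos; omega
        exact hn ⟨⟨r, hr0⟩, PNat.coe_injective (by
          change 2 * r = (n : ℕ)
          omega)⟩
      rw [this.neg_one_pow]
      ring
  have h3 : HasSum (fun n : ℕ+ => (-1 : ℝ) ^ (n : ℕ) * F n)
      (2 * ∑' n : ℕ+, F (2 * n) - ∑' n : ℕ+, F n) := by
    have h4 : (fun n : ℕ+ => (-1 : ℝ) ^ (n : ℕ) * F n) =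
        fun n : ℕ+ => (1 + (-1 : ℝ) ^ (n : ℕ)) * F n - F n := by
      funext n
      ring
    rw [h4]
    exact h1.sub hF'.hasSum
  exact h3.tsum_eq

/-- From `1/sinh u = coth(u/2) - coth u`; correspondingly, an alternating sum is twice its even part
minus the full sum. -/
lemma pi_div_sinh_eq_poleSum {x : ℝ} (hx : 0 < x) :
    Real.pi / Real.sinh (Real.pi * x) = 1 / x + 2 * x * poleSum (-1) (x ^ 2) := by
  have h1 := realCoth_eq_poleSum hx
  have h2 := realCoth_eq_poleSum (half_pos hx)
  have h3 : poleSum (-1) (x ^ 2) = 1 / 2 * poleSum 1 ((x / 2) ^ 2) - poleSum 1 (x ^ 2) := by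
    rw [poleSum, tsum_neg_one_pow_mul (summable_abs_one_div_add (by positivity)), poleSum, poleSum,
      ← tsum_mul_left, ← tsum_mul_left]
    congr 1
    · refine tsum_congr fun n => ?_
      push_cast [PNat.mul_coe]
      field_simp
      simp
    · simp
  have hs : 0 < Real.sinh (Real.pi * (x / 2)) := Real.sinh_pos_iff.mpr (by positivity)
  have hc : 0 < Real.cosh (Real.pi * (x / 2)) := Real.cosh_pos _
  have h4 : Real.pi / Real.sinh (Real.pi * x) =
      Real.pi * realCoth (Real.pi * (x / 2)) - Real.pi * realCoth (Real.pi * x) := by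
    have e : Real.pi * x = 2 * (Real.pi * (x / 2)) := by ring
    rw [e, realCoth, realCoth, Real.sinh_two_mul, Real.cosh_two_mul]
    have := Real.cosh_sq (Real.pi * (x / 2))
    set c := Real.cosh (Real.pi * (x / 2))
    set d := Real.sinh (Real.pi * (x / 2))
    rw [this]
    field_simp
    linear_combination (-2 : ℝ) * this
  rw [h4, h1, h2, h3]
  field_simp
  ring

lemma signZeta_neg_one {j : ℕ} (hj : 1 ≤ j) :
    signZeta (-1) j = (2 / 2 ^ (2 * j) - 1) * signZeta 1 j := by
  rw [signZeta, tsum_neg_one_pow_mul (summable_abs_one_div_pow hj), signZeta]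
  simp only [one_pow, one_mul]
  rw [sub_mul, one_mul, ← tsum_mul_left, ← tsum_mul_left]
  congr 1
  refine tsum_congr fun n => ?_
  push_cast [PNat.mul_coe]
  rw [mul_pow]
  field_simp

lemma riemannZeta_two_mul {j : ℕ} (hj : 1 ≤ j) : riemannZeta (2 * j) = (signZeta 1 j : ℝ) := by
  have h : riemannZeta ((2 * j : ℕ) : ℂ) = ∑' n : ℕ, 1 / ((n : ℂ) + 1) ^ ((2 * j : ℕ) : ℂ) :=
    zeta_eq_tsum_one_div_nat_add_one_cpow (by
      rw [Complex.natCast_re]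
      exact_mod_cast (by omega : 1 < 2 * j))
  simp only [Complex.cpow_natCast] at h
  have h2 := tsum_pnat_eq_tsum_succ (f := fun n : ℕ => 1 / (n : ℂ) ^ (2 * j))
  push_cast at h h2
  rw [h, ← h2, signZeta, Complex.ofReal_tsum]
  refine tsum_congr fun n => ?_
  push_cast
  simp

lemma altZeta_two_mul {j : ℕ} : altZeta (2 * j) = ((-signZeta (-1) j : ℝ) : ℂ) := by
  rw [altZeta, signZeta, ← tsum_neg, Complex.ofReal_tsum]
  refine tsum_congr fun n => ?_
  have : ((n : ℕ) : ℂ) ^ (2 * j : ℂ) = ((n : ℕ) : ℂ) ^ (2 * j : ℕ) := by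
    rw [← Complex.cpow_natCast]; push_cast; rfl
  rw [this]
  obtain ⟨m, hm⟩ := Nat.exists_eq_add_of_le' n.pos
  rw [hm]
  simp only [Nat.succ_eq_add_one, zero_add, Nat.add_sub_cancel]
  push_cast
  ring

lemma signZeta_one_one : signZeta 1 1 = Real.pi ^ 2 / 6 := by
  have h := riemannZeta_two_mul le_rfl
  simp only [Nat.cast_one, mul_one] at h
  rw [riemannZeta_two] at h
  exact_mod_cast h.symm

/-- `1/x² - 2 ∑ sⁿ/(x²+n²) + 4x² ∑ sⁿ/(x²+n²)²`, the double-pole partial fraction. -/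
noncomputable def doublePole (s x : ℝ) : ℝ :=
  1 / x ^ 2 - 2 * poleSum s (x ^ 2) + 4 * x ^ 2 * poleSqSum s (x ^ 2)

/-- Squaring the expansion of `π coth πx` avoids termwise differentiation: `poleSum_mul_poleSum`
expands the square, and its constant `6 ζ(2) = π²` accounts for `coth² - 1 = csch²`. -/
lemma doublePole_one {x : ℝ} (hx : 0 < x) :
    doublePole 1 x = Real.pi ^ 2 / Real.sinh (Real.pi * x) ^ 2 := by
  have h := poleSum_mul_poleSum (one_pow 2) (one_pow 2) (by positivity : 0 < x ^ 2)
  have h1 := realCoth_eq_poleSum hx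
  have h2 : realCoth (Real.pi * x) ^ 2 = 1 + 1 / Real.sinh (Real.pi * x) ^ 2 := by
    have hs : 0 < Real.sinh (Real.pi * x) := Real.sinh_pos_iff.mpr (by positivity)
    rw [realCoth, div_pow, Real.cosh_sq]
    field_simp
  have h3 : Real.pi ^ 2 / Real.sinh (Real.pi * x) ^ 2 =
      (Real.pi * realCoth (Real.pi * x)) ^ 2 - Real.pi ^ 2 := by
    rw [mul_pow, h2]; ring
  rw [mul_one, signZeta_one_one] at h
  rw [h3, h1, doublePole]
  have h4 : (1 / x + 2 * x * poleSum 1 (x ^ 2)) ^ 2 =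
      1 / x ^ 2 + 4 * poleSum 1 (x ^ 2) + 4 * x ^ 2 * (poleSum 1 (x ^ 2) * poleSum 1 (x ^ 2)) := by
    field_simp
    ring
  rw [h4, h]
  field_simp
  ring

/-- Here the product is `π coth πx · π / sinh πx`, and the constant `Z_1(1) + 2 Z_{-1}(1)` vanishes.
-/
lemma doublePole_neg_one {x : ℝ} (hx : 0 < x) :
    doublePole (-1) x =
      Real.pi ^ 2 * Real.cosh (Real.pi * x) / Real.sinh (Real.pi * x) ^ 2 := by
  have h := poleSum_mul_poleSum (one_pow 2) (neg_one_sq) (by positivity : 0 < x ^ 2)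
  have h3 : Real.pi ^ 2 * Real.cosh (Real.pi * x) / Real.sinh (Real.pi * x) ^ 2 =
      (Real.pi * realCoth (Real.pi * x)) * (Real.pi / Real.sinh (Real.pi * x)) := by
    rw [realCoth]; ring
  rw [one_mul, signZeta_neg_one le_rfl] at h
  rw [h3, realCoth_eq_poleSum hx, pi_div_sinh_eq_poleSum hx, doublePole]
  have h4 : (1 / x + 2 * x * poleSum 1 (x ^ 2)) * (1 / x + 2 * x * poleSum (-1) (x ^ 2)) =
      1 / x ^ 2 + 2 * poleSum 1 (x ^ 2) + 2 * poleSum (-1) (x ^ 2) +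
        4 * x ^ 2 * (poleSum 1 (x ^ 2) * poleSum (-1) (x ^ 2)) := by
    field_simp
    ring
  rw [h4, h]
  field_simp
  ring

/-! ### The double sum over `m²` and `n²`, and the relation for one sign. -/

/-- The combination on the left is chosen so that the poles along `x + y = 0` cancel. Passing from
`k` to `k + 1` divides by `x` and adds one monomial. -/
lemma partial_fraction_identity {x y : ℝ} (hx : 0 < x) (hy : 0 < y) (k : ℕ) :
    1 / x ^ k * (-2 / (x + y) + 4 * x / (x + y) ^ 2) +
      (-1) ^ k * (1 / y ^ k * ((4 * k - 2) / (x + y) + 4 * y / (x + y) ^ 2)) =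
    -∑ i ∈ Finset.range k, (-1) ^ i * (4 * i + 2) * (1 / x ^ (k - i) * (1 / y ^ (i + 1))) := by
  have hxy : x + y ≠ 0 := by positivity
  induction k with
  | zero =>
    simp
    field_simp
    ring
  | succ k ih =>
    have h : ∑ i ∈ Finset.range (k + 1),
        (-1 : ℝ) ^ i * (4 * i + 2) * (1 / x ^ (k + 1 - i) * (1 / y ^ (i + 1))) =
        1 / x * (∑ i ∈ Finset.range k,
          (-1 : ℝ) ^ i * (4 * i + 2) * (1 / x ^ (k - i) * (1 / y ^ (i + 1)))) +
        1 / x * ((-1) ^ k * (4 * k + 2) * (1 / y ^ (k + 1))) := by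
      rw [Finset.sum_range_succ, Finset.mul_sum]
      congr 1
      · refine Finset.sum_congr rfl fun i hi => ?_
        rw [Nat.succ_sub (Finset.mem_range.mp hi).le, pow_succ]
        field_simp
      · rw [Nat.add_sub_cancel_left, pow_one]
        ring
    rw [h, neg_add, ← mul_neg, ← ih]
    push_cast
    rw [pow_succ x, pow_succ y, pow_succ (-1 : ℝ)]
    generalize (-1 : ℝ) ^ k = e
    field_simp
    ring

/-- `1/x + 2x ∑ sⁿ/(x²+n²)`, the simple-pole partial fraction. -/
noncomputable def simplePole (s x : ℝ) : ℝ := 1 / x + 2 * x * poleSum s (x ^ 2)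

lemma abs_tsum_le_signZeta {s : ℝ} (hs : s ^ 2 = 1) {f : ℕ+ → ℝ} (h0 : ∀ n, 0 ≤ f n)
    (h : ∀ n, f n ≤ 1 / ((n : ℕ) : ℝ) ^ 2) : |∑' n : ℕ+, s ^ (n : ℕ) * f n| ≤ signZeta 1 1 := by
  have hf := summable_of_le_one_div_sq h0 h
  have h1 : ∀ n : ℕ+, |s ^ (n : ℕ) * f n| = f n := fun n => by
    rw [abs_mul, abs_pow_of_sq_eq_one hs, one_mul, abs_of_nonneg (h0 n)]
  have h2 : ‖∑' n : ℕ+, s ^ (n : ℕ) * f n‖ ≤ ∑' n : ℕ+, ‖s ^ (n : ℕ) * f n‖ :=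
    norm_tsum_le_tsum_norm (hf.congr fun n => (h1 n).symm)
  have h3 : ∑' n : ℕ+, ‖s ^ (n : ℕ) * f n‖ = ∑' n, f n := tsum_congr h1
  rw [h3] at h2
  refine h2.trans ?_
  rw [signZeta]
  simp only [one_pow, one_mul, mul_one]
  exact hf.tsum_le_tsum h summable_pnat_one_div_sq

lemma abs_poleSum_le {s x : ℝ} (hs : s ^ 2 = 1) (hx : 0 ≤ x) : |poleSum s x| ≤ signZeta 1 1 :=
  abs_tsum_le_signZeta hs (fun _ => by positivity) fun n =>
    one_div_le_one_div_of_le (by positivity) (by linarith)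

lemma mul_one_div_sq_le {x y : ℝ} (hx : 0 ≤ x) (hy : 0 < y) : x * (1 / (x + y) ^ 2) ≤ 1 / y := by
  rw [mul_one_div, div_le_div_iff₀ (by positivity) hy]
  nlinarith [mul_nonneg hx hy.le, sq_nonneg x, sq_nonneg y]

lemma abs_mul_poleSqSum_le {s x : ℝ} (hs : s ^ 2 = 1) (hx : 0 ≤ x) :
    |x * poleSqSum s x| ≤ signZeta 1 1 := by
  have h : x * poleSqSum s x =
      ∑' n : ℕ+, s ^ (n : ℕ) * (x * (1 / (x + ((n : ℕ) : ℝ) ^ 2) ^ 2)) := by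
    rw [poleSqSum, ← tsum_mul_left]
    refine tsum_congr fun n => ?_
    ring
  rw [h]
  exact abs_tsum_le_signZeta hs (fun _ => by positivity) fun n =>
    mul_one_div_sq_le hx (by positivity)

lemma summable_bounded_mul {c f : ℕ+ → ℝ} {C : ℝ} (hf : Summable fun n => |f n|)
    (hc : ∀ n, |c n| ≤ C) : Summable fun n => |c n * f n| := by
  refine Summable.of_nonneg_of_le (fun _ => abs_nonneg _) (fun n => ?_) (hf.mul_left C)
  rw [abs_mul]
  exact mul_le_mul_of_nonneg_right (hc n) (abs_nonneg _)

lemma summable_doublePole {s : ℝ} (hs : s ^ 2 = 1) {k : ℕ} (hk : 1 ≤ k) :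
    Summable fun n : ℕ+ => |doublePole s (n : ℕ) * (1 / ((n : ℕ) : ℝ) ^ (2 * k))| := by
  refine summable_bounded_mul (C := 1 + 6 * signZeta 1 1) (summable_abs_one_div_pow hk) fun n => ?_
  have h1 := abs_le.mp (abs_poleSum_le hs (sq_nonneg ((n : ℕ) : ℝ)))
  have h2 := abs_le.mp (abs_mul_poleSqSum_le hs (sq_nonneg ((n : ℕ) : ℝ)))
  have h3 : 1 / ((n : ℕ) : ℝ) ^ 2 ≤ 1 := by
    rw [div_le_one (by positivity)]
    exact one_le_pow₀ (one_le_pnat_cast n)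
  have h4 : 0 ≤ 1 / ((n : ℕ) : ℝ) ^ 2 := by positivity
  rw [doublePole, abs_le]
  constructor <;> linarith

lemma summable_simplePole {s : ℝ} (hs : s ^ 2 = 1) {k : ℕ} (hk : 1 ≤ k) :
    Summable fun n : ℕ+ => |simplePole s (n : ℕ) * (1 / ((n : ℕ) : ℝ) ^ (2 * k + 1))| := by
  have h := summable_bounded_mul (C := 1 + 2 * signZeta 1 1)
    (c := fun n : ℕ+ => 1 / ((n : ℕ) : ℝ) ^ 2 + 2 * poleSum s (((n : ℕ) : ℝ) ^ 2))
    (summable_abs_one_div_pow hk) fun n => by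
      have h1 := abs_le.mp (abs_poleSum_le hs (sq_nonneg ((n : ℕ) : ℝ)))
      have h3 : 1 / ((n : ℕ) : ℝ) ^ 2 ≤ 1 := by
        rw [div_le_one (by positivity)]
        exact one_le_pow₀ (one_le_pnat_cast n)
      have h4 : 0 ≤ 1 / ((n : ℕ) : ℝ) ^ 2 := by positivity
      rw [abs_le]
      constructor <;> linarith
  refine h.congr fun n => ?_
  congr 1
  have : ((n : ℕ) : ℝ) ≠ 0 := by positivity
  rw [simplePole, pow_succ _ (2 * k)]
  field_simp

lemma summable_pair_of_le {f : ℕ+ × ℕ+ → ℝ} {C : ℝ}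
    (h : ∀ p, |f p| ≤ C * (1 / ((p.1 : ℕ) : ℝ) ^ 2 * (1 / ((p.2 : ℕ) : ℝ) ^ 2))) :
    Summable f := by
  have h1 := (tsum_pair_mul (one_pow 2) (one_pow 2) (summable_abs_one_div_pow le_rfl)
    (summable_abs_one_div_pow le_rfl)).summable
  simp only [one_pow, one_mul, mul_one] at h1
  exact Summable.of_norm_bounded (h1.mul_left C) h

/-- One factor `1/x` comes from `k ≥ 1` and `1/y` from the bracket; with `x`, `y` squares of indices
this bound is summable over pairs. -/
lemma abs_double_pole_term_le {x y a : ℝ} (hx : 1 ≤ x) (hy : 1 ≤ y) (c : ℝ) {k : ℕ} (hk : 1 ≤ k)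
    (ha : |a| = 1) :
    |a * (1 / x ^ k * (c / (x + y) + 4 * x / (x + y) ^ 2))| ≤ (|c| + 4) * (1 / x * (1 / y)) := by
  have hx0 : 0 < x := by linarith
  have hy0 : 0 < y := by linarith
  have h1 : 1 / x ^ k ≤ 1 / x := one_div_le_one_div_of_le hx0 (le_self_pow₀ hx (by omega))
  have h2 : |c / (x + y)| ≤ |c| * (1 / y) := by
    rw [abs_div, abs_of_pos (by positivity : 0 < x + y), div_eq_mul_one_div]
    exact mul_le_mul_of_nonneg_left (one_div_le_one_div_of_le hy0 (by linarith)) (abs_nonneg _)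
  have h3 : |4 * x / (x + y) ^ 2| ≤ 4 * (1 / y) := by
    rw [abs_of_nonneg (by positivity)]
    have := mul_one_div_sq_le hx0.le hy0
    have h4 : 4 * x / (x + y) ^ 2 = 4 * (x * (1 / (x + y) ^ 2)) := by ring
    linarith
  rw [abs_mul, ha, one_mul, abs_mul, abs_of_nonneg (by positivity : 0 ≤ 1 / x ^ k)]
  calc _ ≤ 1 / x * ((|c| + 4) * (1 / y)) := by
        refine mul_le_mul h1 ((abs_add_le _ _).trans ?_) (abs_nonneg _) (by positivity)
        linarith
    _ = _ := by ring

lemma hasSum_pole_fiber {s : ℝ} (hs : s ^ 2 = 1) {x : ℝ} (hx : 0 ≤ x) (c b : ℝ) :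
    HasSum (fun n : ℕ+ => s ^ (n : ℕ) * (b * (c / (x + ((n : ℕ) : ℝ) ^ 2) +
      4 * x / (x + ((n : ℕ) : ℝ) ^ 2) ^ 2)))
      (b * (c * poleSum s x + 4 * x * poleSqSum s x)) := by
  have h1 := (summable_pow_mul hs (summable_abs_one_div_add hx)).hasSum.mul_left c
  have h2 := (summable_pow_mul hs (summable_abs_one_div_add_sq hx)).hasSum.mul_left (4 * x)
  have h3 : (fun n : ℕ+ => s ^ (n : ℕ) * (b * (c / (x + ((n : ℕ) : ℝ) ^ 2) +
      4 * x / (x + ((n : ℕ) : ℝ) ^ 2) ^ 2))) = fun n : ℕ+ =>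
      b * (c * (s ^ (n : ℕ) * (1 / (x + ((n : ℕ) : ℝ) ^ 2))) +
        4 * x * (s ^ (n : ℕ) * (1 / (x + ((n : ℕ) : ℝ) ^ 2) ^ 2))) := by
    funext n
    ring
  rw [h3]
  exact (h1.add h2).mul_left b

lemma one_le_sq_cast (n : ℕ+) : (1 : ℝ) ≤ ((n : ℕ) : ℝ) ^ 2 := one_le_pow₀ (one_le_pnat_cast n)

/-- Summing `A` and `B` over their second index gives the hyperbolic series. Exchanging the indices
in `B` puts `s` on the first index in both, and the combined terms then fall under
`partial_fraction_identity`. -/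
theorem sum_doublePole_add {s : ℝ} (hs : s ^ 2 = 1) {k : ℕ} (hk : 1 ≤ k) :
    (∑' n : ℕ+, s ^ (n : ℕ) * (doublePole 1 (n : ℕ) * (1 / ((n : ℕ) : ℝ) ^ (2 * k)))) +
      2 * k * (-1) ^ k * (∑' n : ℕ+, simplePole s (n : ℕ) * (1 / ((n : ℕ) : ℝ) ^ (2 * k + 1))) +
      (-1) ^ k * (∑' n : ℕ+, doublePole s (n : ℕ) * (1 / ((n : ℕ) : ℝ) ^ (2 * k))) =
    signZeta s (k + 1) + (2 * k + 1) * (-1) ^ k * signZeta 1 (k + 1) -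
      ∑ i ∈ Finset.range k, (-1) ^ i * (4 * i + 2) * (signZeta s (k - i) * signZeta 1 (i + 1)) := by
  have h1 : (1 : ℝ) ^ 2 = 1 := one_pow 2
  have hk1 : 1 ≤ k + 1 := by omega
  set A : ℕ+ × ℕ+ → ℝ := fun p => s ^ (p.1 : ℕ) * (1 / (((p.1 : ℕ) : ℝ) ^ 2) ^ k *
    (-2 / (((p.1 : ℕ) : ℝ) ^ 2 + ((p.2 : ℕ) : ℝ) ^ 2) +
      4 * ((p.1 : ℕ) : ℝ) ^ 2 / (((p.1 : ℕ) : ℝ) ^ 2 + ((p.2 : ℕ) : ℝ) ^ 2) ^ 2)) with hA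
  set B : ℕ+ × ℕ+ → ℝ := fun p => s ^ (p.2 : ℕ) * (1 / (((p.1 : ℕ) : ℝ) ^ 2) ^ k *
    ((4 * k - 2) / (((p.1 : ℕ) : ℝ) ^ 2 + ((p.2 : ℕ) : ℝ) ^ 2) +
      4 * ((p.1 : ℕ) : ℝ) ^ 2 / (((p.1 : ℕ) : ℝ) ^ 2 + ((p.2 : ℕ) : ℝ) ^ 2) ^ 2)) with hB
  have hAs : Summable A := summable_pair_of_le fun p =>
    abs_double_pole_term_le (one_le_sq_cast p.1) (one_le_sq_cast p.2) _ hk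
      (abs_pow_of_sq_eq_one hs _)
  have hBs : Summable B := summable_pair_of_le fun p =>
    abs_double_pole_term_le (one_le_sq_cast p.1) (one_le_sq_cast p.2) _ hk
      (abs_pow_of_sq_eq_one hs _)
  have hAf : HasSum (fun n : ℕ+ => s ^ (n : ℕ) * (1 / (((n : ℕ) : ℝ) ^ 2) ^ k *
      (-2 * poleSum 1 (((n : ℕ) : ℝ) ^ 2) + 4 * ((n : ℕ) : ℝ) ^ 2 *
        poleSqSum 1 (((n : ℕ) : ℝ) ^ 2)))) (∑' p, A p) := by
    refine HasSum.prod_fiberwise hAs.hasSum fun n => ?_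
    have := (hasSum_pole_fiber h1 (sq_nonneg ((n : ℕ) : ℝ)) (-2)
      (1 / (((n : ℕ) : ℝ) ^ 2) ^ k)).mul_left (s ^ (n : ℕ))
    simpa only [one_pow, one_mul] using this
  have hBf : HasSum (fun n : ℕ+ => (1 / (((n : ℕ) : ℝ) ^ 2) ^ k *
      ((4 * k - 2) * poleSum s (((n : ℕ) : ℝ) ^ 2) + 4 * ((n : ℕ) : ℝ) ^ 2 *
        poleSqSum s (((n : ℕ) : ℝ) ^ 2)))) (∑' p, B p) :=
    HasSum.prod_fiberwise hBs.hasSum fun n => hasSum_pole_fiber hs (sq_nonneg _) _ _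
  have hBsw : HasSum (fun p : ℕ+ × ℕ+ => B p.swap) (∑' p, B p) :=
    (Equiv.prodComm ℕ+ ℕ+).hasSum_iff.mpr hBs.hasSum
  have hR := (hasSum_sum (s := Finset.range k) fun i hi => (tsum_pair_mul hs h1
    (summable_abs_one_div_pow (Nat.sub_pos_of_lt (Finset.mem_range.mp hi)))
    (summable_abs_one_div_pow (Nat.le_add_left 1 i))).mul_left ((-1 : ℝ) ^ i * (4 * i + 2))).neg
  have hAB := hAs.hasSum.add (hBsw.mul_left ((-1) ^ k))
  have hfun : (fun p : ℕ+ × ℕ+ => A p + (-1) ^ k * B p.swap) = fun p : ℕ+ × ℕ+ =>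
      -∑ i ∈ Finset.range k, (-1 : ℝ) ^ i * (4 * i + 2) * (s ^ (p.1 : ℕ) * 1 ^ (p.2 : ℕ) *
        (1 / ((p.1 : ℕ) : ℝ) ^ (2 * (k - i)) * (1 / ((p.2 : ℕ) : ℝ) ^ (2 * (i + 1))))) := by
    funext p
    have hid := partial_fraction_identity (lt_of_lt_of_le one_pos (one_le_sq_cast p.1))
      (lt_of_lt_of_le one_pos (one_le_sq_cast p.2)) k
    have h2 : A p + (-1) ^ k * B p.swap = s ^ (p.1 : ℕ) * (1 / (((p.1 : ℕ) : ℝ) ^ 2) ^ k *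
        (-2 / (((p.1 : ℕ) : ℝ) ^ 2 + ((p.2 : ℕ) : ℝ) ^ 2) +
          4 * ((p.1 : ℕ) : ℝ) ^ 2 / (((p.1 : ℕ) : ℝ) ^ 2 + ((p.2 : ℕ) : ℝ) ^ 2) ^ 2) +
        (-1) ^ k * (1 / (((p.2 : ℕ) : ℝ) ^ 2) ^ k *
          ((4 * k - 2) / (((p.1 : ℕ) : ℝ) ^ 2 + ((p.2 : ℕ) : ℝ) ^ 2) +
          4 * ((p.2 : ℕ) : ℝ) ^ 2 / (((p.1 : ℕ) : ℝ) ^ 2 + ((p.2 : ℕ) : ℝ) ^ 2) ^ 2))) := by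
      simp only [hA, hB, Prod.fst_swap, Prod.snd_swap]
      rw [add_comm (((p.2 : ℕ) : ℝ) ^ 2)]
      ring
    rw [h2, hid, mul_neg, Finset.mul_sum]
    congr 1
    refine Finset.sum_congr rfl fun i _ => ?_
    rw [pow_mul, pow_mul, one_pow]
    ring
  rw [hfun] at hAB
  have hmain := hAB.unique hR
  -- The inner sums lack the term `1/n²` of `doublePole`; restoring it costs `Z_s(k + 1)`.
  have eA : ∑' p, A p = (∑' n : ℕ+, s ^ (n : ℕ) *
      (doublePole 1 (n : ℕ) * (1 / ((n : ℕ) : ℝ) ^ (2 * k)))) - signZeta s (k + 1) := by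
    rw [← hAf.tsum_eq, signZeta,
      ← (summable_pow_mul hs (summable_doublePole h1 hk)).tsum_sub
        (summable_pow_mul hs (summable_abs_one_div_pow hk1))]
    refine tsum_congr fun n => ?_
    have : ((n : ℕ) : ℝ) ≠ 0 := by positivity
    rw [doublePole, mul_add 2 k 1, pow_add, ← pow_mul]
    field_simp
    ring
  -- The coefficient `4k - 2` splits as `-2` for `doublePole` and `4k` for `2k` copies of
  -- `simplePole`; the missing `1/n²` terms number `1 + 2k`.
  have eB : ∑' p, B p = (∑' n : ℕ+, doublePole s (n : ℕ) * (1 / ((n : ℕ) : ℝ) ^ (2 * k))) +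
      2 * k * (∑' n : ℕ+, simplePole s (n : ℕ) * (1 / ((n : ℕ) : ℝ) ^ (2 * k + 1))) -
        (2 * k + 1) * signZeta 1 (k + 1) := by
    have s1 := (summable_abs_iff.mp (summable_doublePole hs hk)).hasSum
    have s2 := (summable_abs_iff.mp (summable_simplePole hs hk)).hasSum.mul_left (2 * (k : ℝ))
    have s3 := (summable_pow_mul h1 (summable_abs_one_div_pow hk1)).hasSum.mul_left (2 * (k : ℝ) + 1)
    rw [← hBf.tsum_eq, signZeta, ← ((s1.add s2).sub s3).tsum_eq]
    refine tsum_congr fun n => ?_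
    have : ((n : ℕ) : ℝ) ≠ 0 := by positivity
    rw [doublePole, simplePole, mul_add 2 k 1, pow_add _ (2 * k) (2 * 1), pow_succ _ (2 * k), ← pow_mul,
      one_pow]
    field_simp
    ring
  change _ = -∑ i ∈ Finset.range k,
    (-1 : ℝ) ^ i * (4 * i + 2) * (signZeta s (k - i) * signZeta 1 (i + 1)) at hmain
  rw [eA, eB] at hmain
  linear_combination hmain

/-! ### Finite sums over pairs and triples. -/

lemma mem_posPairs {m : ℕ} {p : ℕ × ℕ} :
    p ∈ posPairs m ↔ 1 ≤ p.1 ∧ 1 ≤ p.2 ∧ p.1 + p.2 = m := by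
  simp only [posPairs, Finset.mem_filter, Finset.mem_product, Finset.mem_Icc]
  omega

lemma mem_posTriples {m : ℕ} {p : ℕ × ℕ × ℕ} :
    p ∈ posTriples m ↔ 1 ≤ p.1 ∧ 1 ≤ p.2.1 ∧ 1 ≤ p.2.2 ∧ p.1 + p.2.1 + p.2.2 = m := by
  simp only [posTriples, Finset.mem_filter, Finset.mem_product, Finset.mem_Icc]
  omega

lemma sum_posPairs_succ {R : Type*} [AddCommMonoid R] (k : ℕ) (F : ℕ → ℕ → R) :
    ∑ p ∈ posPairs (k + 1), F p.1 p.2 = ∑ i ∈ Finset.range k, F (k - i) (i + 1) := by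
  refine Finset.sum_bij' (fun p _ => p.2 - 1) (fun i _ => (k - i, i + 1)) ?_ ?_ ?_ ?_ ?_
  · intro p hp
    have := mem_posPairs.mp hp
    simp only [Finset.mem_range]
    omega
  · intro i hi
    have := Finset.mem_range.mp hi
    rw [mem_posPairs]
    simp only
    omega
  · intro p hp
    have := mem_posPairs.mp hp
    ext <;> simp only <;> omega
  · intro i hi
    simp
  · intro p hp
    have := mem_posPairs.mp hp
    congr 1 <;> omega

lemma sum_posPairs_antidiagonal {R : Type*} [AddCommMonoid R] (M : ℕ) (F : ℕ → ℕ → R) :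
    ∑ p ∈ posPairs (M + 2), F p.1 p.2 =
      ∑ p ∈ Finset.HasAntidiagonal.antidiagonal M, F (p.1 + 1) (p.2 + 1) := by
  refine Finset.sum_bij' (fun p _ => (p.1 - 1, p.2 - 1)) (fun p _ => (p.1 + 1, p.2 + 1))
    ?_ ?_ ?_ ?_ ?_
  · intro p hp
    have := mem_posPairs.mp hp
    rw [Finset.HasAntidiagonal.mem_antidiagonal]
    simp only
    omega
  · intro p hp
    have := Finset.HasAntidiagonal.mem_antidiagonal.mp hp
    rw [mem_posPairs]
    simp only
    omega
  · intro p hp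
    have := mem_posPairs.mp hp
    ext <;> simp only <;> omega
  · intro p hp
    simp
  · intro p hp
    have := mem_posPairs.mp hp
    congr 1 <;> simp only <;> omega

/-- The third index is split off because the sign `(-1)^(k₁+k₂)` is constant on the remaining pairs.
-/
lemma sum_posTriples {R : Type*} [AddCommMonoid R] (m : ℕ) (F : ℕ → ℕ → ℕ → R) :
    ∑ p ∈ posTriples m, F p.1 p.2.1 p.2.2 =
      ∑ q ∈ posPairs m, ∑ r ∈ posPairs q.2, F r.1 r.2 q.1 := by
  rw [Finset.sum_sigma']
  refine Finset.sum_bij' (fun p _ => ⟨(p.2.2, p.1 + p.2.1), (p.1, p.2.1)⟩)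
    (fun q _ => (q.2.1, q.2.2, q.1.1)) ?_ ?_ ?_ ?_ ?_
  · intro p hp
    have := mem_posTriples.mp hp
    simp only [Finset.mem_sigma, mem_posPairs]
    refine ⟨⟨?_, ?_, ?_⟩, ?_, ?_, trivial⟩ <;> omega
  · intro q hq
    simp only [Finset.mem_sigma, mem_posPairs] at hq
    rw [mem_posTriples]
    simp only
    omega
  · intro p hp
    rfl
  · rintro ⟨⟨a, b⟩, ⟨c, d⟩⟩ hq
    simp only [Finset.mem_sigma, mem_posPairs] at hq
    obtain ⟨_, _, _, h⟩ := hq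
    subst h
    rfl
  · intro p hp
    rfl

/-- The convolution of even zeta values, with the empty case `M = 1` corrected. -/
lemma sum_posPairs_signZeta {s : ℝ} (hs : s ^ 2 = 1) {M : ℕ} (hM : 1 ≤ M) :
    ∑ p ∈ posPairs M, signZeta s p.1 * signZeta s p.2 =
      ((M - 1 / 2) * signZeta 1 M + signZeta s M) -
        if M = 1 then signZeta 1 1 / 2 + signZeta s 1 else 0 := by
  rcases Nat.lt_or_ge M 2 with h | h
  · obtain rfl : M = 1 := by omega
    have : posPairs 1 = ∅ := by
      ext p
      rw [mem_posPairs]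
      simp
      omega
    rw [this, if_pos rfl]
    simp
    ring
  · obtain ⟨N, rfl⟩ := Nat.exists_eq_add_of_le' h
    rw [sum_posPairs_antidiagonal N fun a b => signZeta s a * signZeta s b,
      sum_antidiagonal_signZeta_mul hs hs, if_neg (by omega), ← pow_two, hs]
    push_cast
    ring

/-- The inner pair sum is a convolution. Its defect occurs only when `k₁ + k₂ = 1`, that is at the
outer pair `(k, 1)`, where the sign `(-1)^1` makes the correction positive. -/
lemma sum_posTriples_signZeta {s t : ℝ} (ht : t ^ 2 = 1) {k : ℕ} (hk : 1 ≤ k) :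
    ∑ p ∈ posTriples (k + 1), (-1 : ℝ) ^ (p.1 + p.2.1) *
        (signZeta t p.1 * signZeta t p.2.1 * signZeta s p.2.2) =
      (∑ p ∈ posPairs (k + 1), (-1) ^ p.2 *
        (signZeta s p.1 * ((p.2 - 1 / 2) * signZeta 1 p.2 + signZeta t p.2))) +
        signZeta s k * (signZeta 1 1 / 2 + signZeta t 1) := by
  rw [sum_posTriples (k + 1) fun a b c => (-1 : ℝ) ^ (a + b) *
        (signZeta t a * signZeta t b * signZeta s c)]
  have h1 : ∀ q ∈ posPairs (k + 1), ∑ r ∈ posPairs q.2, (-1 : ℝ) ^ (r.1 + r.2) *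
        (signZeta t r.1 * signZeta t r.2 * signZeta s q.1) =
      (-1) ^ q.2 *
        (signZeta s q.1 * ((q.2 - 1 / 2) * signZeta 1 q.2 + signZeta t q.2)) +
      if q = (k, 1) then signZeta s k * (signZeta 1 1 / 2 + signZeta t 1) else 0 := by
    intro q hq
    have hq' := mem_posPairs.mp hq
    have h2 : ∑ r ∈ posPairs q.2, (-1 : ℝ) ^ (r.1 + r.2) *
        (signZeta t r.1 * signZeta t r.2 * signZeta s q.1) =
        (-1) ^ q.2 * signZeta s q.1 * ∑ r ∈ posPairs q.2, signZeta t r.1 * signZeta t r.2 := by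
      rw [Finset.mul_sum]
      refine Finset.sum_congr rfl fun r hr => ?_
      rw [(mem_posPairs.mp hr).2.2]
      ring
    rw [h2, sum_posPairs_signZeta ht hq'.2.1]
    by_cases h : q.2 = 1
    · have h3 : q = (k, 1) := Prod.ext (by simp only; omega) h
      subst h3
      simp
      ring
    · rw [if_neg h, if_neg fun h3 => h (by rw [h3])]
      ring
  rw [Finset.sum_congr rfl h1, Finset.sum_add_distrib, Finset.sum_ite_eq',
    if_pos (mem_posPairs (p := (k, 1)).mpr ⟨hk, le_rfl, rfl⟩)]

/-! ### The relation for two signs and its four specialisations. -/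

/-- The relation for general signs; `2ζ(2) + 4 signZeta t 1` is `π²` for `t = 1` and `0` for
`t = -1`. -/
theorem main_relation {s t : ℝ} (hs : s ^ 2 = 1) (ht : t ^ 2 = 1) {k : ℕ} (hk : 1 ≤ k) :
    (∑' n : ℕ+, s ^ (n : ℕ) * (doublePole 1 (n : ℕ) * (1 / ((n : ℕ) : ℝ) ^ (2 * k)))) +
      (2 * signZeta 1 1 + 4 * signZeta t 1) * signZeta s k +
      2 * k * (-1) ^ k * (∑' n : ℕ+, simplePole s (n : ℕ) * (1 / ((n : ℕ) : ℝ) ^ (2 * k + 1))) +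
      (-1) ^ k * (∑' n : ℕ+, doublePole s (n : ℕ) * (1 / ((n : ℕ) : ℝ) ^ (2 * k))) =
    4 * ∑ p ∈ posTriples (k + 1), (-1 : ℝ) ^ (p.1 + p.2.1) *
        (signZeta t p.1 * signZeta t p.2.1 * signZeta s p.2.2) -
      4 * ∑ p ∈ posPairs (k + 1), (-1 : ℝ) ^ p.2 * (signZeta s p.1 * signZeta t p.2) +
      signZeta s (k + 1) + (2 * k + 1) * (-1) ^ k * signZeta 1 (k + 1) := by
  have h := sum_doublePole_add hs hk
  have h1 : ∑ i ∈ Finset.range k, (-1 : ℝ) ^ i * (4 * i + 2) *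
      (signZeta s (k - i) * signZeta 1 (i + 1)) =
      -∑ p ∈ posPairs (k + 1), (-1 : ℝ) ^ p.2 *
        (signZeta s p.1 * ((4 * p.2 - 2) * signZeta 1 p.2)) := by
    rw [sum_posPairs_succ k fun a b => (-1 : ℝ) ^ b *
        (signZeta s a * ((4 * b - 2) * signZeta 1 b)), ← Finset.sum_neg_distrib]
    refine Finset.sum_congr rfl fun i _ => ?_
    push_cast
    rw [pow_succ]
    ring
  -- Four times the weight `p.2 - 1/2` is `4i + 2` at `p.2 = i + 1`, the weight in
  -- `sum_doublePole_add`; the unweighted part is what the pair sum in the statement removes.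
  have h2 : ∑ p ∈ posPairs (k + 1), (-1 : ℝ) ^ p.2 *
      (signZeta s p.1 * ((p.2 - 1 / 2) * signZeta 1 p.2 + signZeta t p.2)) =
      1 / 4 * (∑ p ∈ posPairs (k + 1), (-1 : ℝ) ^ p.2 *
        (signZeta s p.1 * ((4 * p.2 - 2) * signZeta 1 p.2))) +
      ∑ p ∈ posPairs (k + 1), (-1 : ℝ) ^ p.2 * (signZeta s p.1 * signZeta t p.2) := by
    rw [Finset.mul_sum, ← Finset.sum_add_distrib]
    refine Finset.sum_congr rfl fun p _ => ?_
    ring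
  rw [sum_posTriples_signZeta ht hk, h2]
  rw [h1] at h
  linear_combination h

lemma pi_mul_pnat_sinh_ne_zero (n : ℕ+) : Real.sinh (Real.pi * (n : ℕ)) ≠ 0 :=
  (Real.sinh_pos_iff.mpr (by positivity)).ne'

lemma cschSqTerm_eq (k : ℕ) (n : ℕ+) :
    cschSqTerm k n = doublePole 1 (n : ℕ) * (1 / ((n : ℕ) : ℝ) ^ (2 * k)) := by
  rw [cschSqTerm, doublePole_one (by positivity)]
  ring

lemma cothSqTerm_eq (k : ℕ) (n : ℕ+) :
    cothSqTerm k n = (doublePole 1 (n : ℕ) + Real.pi ^ 2) * (1 / ((n : ℕ) : ℝ) ^ (2 * k)) := by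
  have h := pi_mul_pnat_sinh_ne_zero n
  rw [cothSqTerm, doublePole_one (by positivity), realCoth, div_pow, Real.cosh_sq]
  field_simp
  ring

lemma coshCschSqTerm_eq (k : ℕ) (n : ℕ+) :
    coshCschSqTerm k n = doublePole (-1) (n : ℕ) * (1 / ((n : ℕ) : ℝ) ^ (2 * k)) := by
  rw [coshCschSqTerm, doublePole_neg_one (by positivity)]
  ring

lemma cschTerm_eq (k : ℕ) (n : ℕ+) :
    cschTerm k n = simplePole (-1) (n : ℕ) * (1 / ((n : ℕ) : ℝ) ^ (2 * k + 1)) := by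
  rw [cschTerm, simplePole, ← pi_div_sinh_eq_poleSum (by positivity)]
  ring

lemma cothTerm_eq (k : ℕ) (n : ℕ+) :
    cothTerm k n = simplePole 1 (n : ℕ) * (1 / ((n : ℕ) : ℝ) ^ (2 * k + 1)) := by
  rw [cothTerm, simplePole, ← realCoth_eq_poleSum (by positivity)]
  ring

theorem mainTheorem9 (k : ℕ) (hk : 1 ≤ k) :
    -- all the series converge (absolutely)
    (Summable (fun n : ℕ+ => cothSqTerm k n * (-1) ^ (n : ℕ)) ∧
      Summable (cothSqTerm k) ∧
      Summable (fun n : ℕ+ => cschSqTerm k n * (-1) ^ (n : ℕ)) ∧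
      Summable (cschSqTerm k) ∧
      Summable (coshCschSqTerm k) ∧
      Summable (cschTerm k) ∧
      Summable (cothTerm k)) ∧
    -- first relation
    (((∑' n : ℕ+, cothSqTerm k n * (-1) ^ (n : ℕ) : ℝ) : ℂ)
        + 2 * k * (-1) ^ k * ((∑' n : ℕ+, cschTerm k n : ℝ) : ℂ)
        + (-1) ^ k * ((∑' n : ℕ+, coshCschSqTerm k n : ℝ) : ℂ)
        + riemannZeta (2 * k + 2) * (1 - 1 / 2 ^ (2 * k + 1) - 2 * (-1) ^ (k + 1))
        + ∑ p ∈ posPairs (k + 1),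
            riemannZeta (2 * p.1) * riemannZeta (2 * p.2) *
              (2 * (-1) ^ (k + 1) - 4 * (-1) ^ p.2 * (1 - 2 / 2 ^ (2 * p.1)))
        + 4 * ∑ p ∈ posTriples (k + 1),
            (-1) ^ (p.1 + p.2.1) * (1 - 2 / 2 ^ (2 * p.2.2)) *
              riemannZeta (2 * p.1) * riemannZeta (2 * p.2.1) * riemannZeta (2 * p.2.2)
      = 0) ∧
    -- second relation
    (((∑' n : ℕ+, cschSqTerm k n * (-1) ^ (n : ℕ) : ℝ) : ℂ)
        + 2 * k * (-1) ^ k * ((∑' n : ℕ+, cschTerm k n : ℝ) : ℂ)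
        + (-1) ^ k * ((∑' n : ℕ+, coshCschSqTerm k n : ℝ) : ℂ)
        + riemannZeta (2 * k + 2) * (1 - 1 / 2 ^ (2 * k + 1)) * (1 + 2 * (-1) ^ (k + 1))
        + 2 * ∑ p ∈ posPairs (k + 1),
            (-1) ^ p.2 * ((-1) ^ p.1 + 2) * altZeta (2 * p.1) * altZeta (2 * p.2)
        + 4 * ∑ p ∈ posTriples (k + 1),
            (-1) ^ (p.1 + p.2.1) *
              altZeta (2 * p.1) * altZeta (2 * p.2.1) * altZeta (2 * p.2.2)
      = 0) ∧
    -- third relation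
    ((1 + (-1) ^ k) * ((∑' n : ℕ+, cschSqTerm k n : ℝ) : ℂ)
        + 2 * k * (-1) ^ k * ((∑' n : ℕ+, cothTerm k n : ℝ) : ℂ)
        + riemannZeta (2 * k + 2) * (2 * (1 - 1 / 2 ^ (2 * k + 1)) * (-1) ^ (k + 1) - 1)
        + 2 * ∑ p ∈ posPairs (k + 1),
            (-1) ^ p.2 * ((1 - 2 / 2 ^ (2 * p.1)) * (-1) ^ p.1 - 2) *
              riemannZeta (2 * p.1) * altZeta (2 * p.2)
        - 4 * ∑ p ∈ posTriples (k + 1),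
            (-1) ^ (p.1 + p.2.1) *
              altZeta (2 * p.1) * altZeta (2 * p.2.1) * riemannZeta (2 * p.2.2)
      = 0) ∧
    -- fourth relation
    (((∑' n : ℕ+, cothSqTerm k n : ℝ) : ℂ)
        + (-1) ^ k * ((∑' n : ℕ+, cschSqTerm k n : ℝ) : ℂ)
        + 2 * k * (-1) ^ k * ((∑' n : ℕ+, cothTerm k n : ℝ) : ℂ)
        + riemannZeta (2 * k + 2) * (2 * (-1) ^ k - 1)
        + 2 * ∑ p ∈ posPairs (k + 1),
            ((-1) ^ (p.1 + p.2) + 2 * (-1) ^ p.2) *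
              riemannZeta (2 * p.1) * riemannZeta (2 * p.2)
        - 4 * ∑ p ∈ posTriples (k + 1),
            (-1) ^ (p.1 + p.2.1) *
              riemannZeta (2 * p.1) * riemannZeta (2 * p.2.1) * riemannZeta (2 * p.2.2)
      = 0) := by
  have hz : ∀ {j : ℕ}, 1 ≤ j → riemannZeta (2 * j) = (signZeta 1 j : ℝ) := riemannZeta_two_mul
  have hz1 : riemannZeta (2 * k + 2) = (signZeta 1 (k + 1) : ℝ) := by
    rw [← riemannZeta_two_mul (Nat.le_add_left 1 k)]
    congr 1
    push_cast
    ring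
  have h1 : (1 : ℝ) ^ 2 = 1 := one_pow 2
  have h2 : (-1 : ℝ) ^ 2 = 1 := neg_one_sq
  have hs1 := summable_pow_mul h2 (summable_doublePole h1 hk)
  have hs2 := summable_abs_iff.mp (summable_doublePole h1 hk)
  have hs3 := summable_abs_iff.mp (summable_doublePole h2 hk)
  have hs4 := summable_abs_iff.mp (summable_simplePole h1 hk)
  have hs5 := summable_abs_iff.mp (summable_simplePole h2 hk)
  have hs6 := summable_pow_mul h2 (summable_abs_one_div_pow hk)
  have hs7 := summable_pow_mul h1 (summable_abs_one_div_pow hk)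
  have e1 : (fun n : ℕ+ => cothSqTerm k n * (-1) ^ (n : ℕ)) = fun n : ℕ+ =>
      (-1 : ℝ) ^ (n : ℕ) * (doublePole 1 (n : ℕ) * (1 / ((n : ℕ) : ℝ) ^ (2 * k))) +
        Real.pi ^ 2 * ((-1 : ℝ) ^ (n : ℕ) * (1 / ((n : ℕ) : ℝ) ^ (2 * k))) := by
    funext n
    rw [cothSqTerm_eq]
    ring
  have e2 : cothSqTerm k = fun n : ℕ+ =>
      doublePole 1 (n : ℕ) * (1 / ((n : ℕ) : ℝ) ^ (2 * k)) +
        Real.pi ^ 2 * ((1 : ℝ) ^ (n : ℕ) * (1 / ((n : ℕ) : ℝ) ^ (2 * k))) := by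
    funext n
    rw [cothSqTerm_eq, one_pow]
    ring
  have e3 : (fun n : ℕ+ => cschSqTerm k n * (-1) ^ (n : ℕ)) = fun n : ℕ+ =>
      (-1 : ℝ) ^ (n : ℕ) * (doublePole 1 (n : ℕ) * (1 / ((n : ℕ) : ℝ) ^ (2 * k))) := by
    funext n
    rw [cschSqTerm_eq]
    ring
  have e4 : cschSqTerm k = fun n : ℕ+ =>
      doublePole 1 (n : ℕ) * (1 / ((n : ℕ) : ℝ) ^ (2 * k)) := funext (cschSqTerm_eq k)
  have e5 : coshCschSqTerm k = fun n : ℕ+ =>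
      doublePole (-1) (n : ℕ) * (1 / ((n : ℕ) : ℝ) ^ (2 * k)) := funext (coshCschSqTerm_eq k)
  have e6 : cschTerm k = fun n : ℕ+ =>
      simplePole (-1) (n : ℕ) * (1 / ((n : ℕ) : ℝ) ^ (2 * k + 1)) := funext (cschTerm_eq k)
  have e7 : cothTerm k = fun n : ℕ+ =>
      simplePole 1 (n : ℕ) * (1 / ((n : ℕ) : ℝ) ^ (2 * k + 1)) := funext (cothTerm_eq k)
  have t1 := hs1.tsum_add (hs6.mul_left (Real.pi ^ 2))
  have t2 := hs2.tsum_add (hs7.mul_left (Real.pi ^ 2))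
  rw [tsum_mul_left] at t1 t2
  change _ = _ + Real.pi ^ 2 * signZeta (-1) k at t1
  change _ = _ + Real.pi ^ 2 * signZeta 1 k at t2
  have hZ := signZeta_one_one
  have hZ' : signZeta (-1) 1 = -(Real.pi ^ 2 / 12) := by
    rw [signZeta_neg_one le_rfl, hZ]
    ring
  have hη : ∀ {j : ℕ}, 1 ≤ j → (1 - 2 / 2 ^ (2 * j)) * signZeta 1 j = -signZeta (-1) j :=
    fun {j} hj => by rw [signZeta_neg_one hj]; ring
  -- The exponent `2k + 1` is `2(k + 1) - 1`, so this is the same factor at `j = k + 1`.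
  have hη1 : (1 - 1 / 2 ^ (2 * k + 1)) * signZeta 1 (k + 1) = -signZeta (-1) (k + 1) := by
    rw [← hη (Nat.le_add_left 1 k)]
    congr 2
    rw [mul_add 2 k 1, pow_add, pow_succ]
    field_simp
    ring
  -- The signs `(s, t)` are `(-1, 1)`, `(-1, -1)`, `(1, -1)`, `(1, 1)` for the first to fourth
  -- relation.
  have r11 := main_relation h1 h1 hk
  have r1n := main_relation h1 h2 hk
  have rn1 := main_relation h2 h1 hk
  have rnn := main_relation h2 h2 hk
  -- The pair sums also contain a part whose sign is constantly `(-1)^(k+1)`; these convolutions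
  -- evaluate it. As `k + 1 ≥ 2`, there is no defect.
  have c1 := sum_posPairs_signZeta h1 (Nat.le_add_left 1 k)
  have cn := sum_posPairs_signZeta h2 (Nat.le_add_left 1 k)
  rw [if_neg (by omega), sub_zero] at c1 cn
  push_cast at c1 cn
  simp only [one_pow, one_mul] at r11 r1n
  have hpm : ∀ p ∈ posPairs (k + 1), (-1 : ℝ) ^ (p.1 + p.2) = (-1) ^ (k + 1) := fun p hp => by
    rw [(mem_posPairs.mp hp).2.2]
  refine ⟨⟨?_, ?_, ?_, ?_, ?_, ?_, ?_⟩, ?_, ?_, ?_, ?_⟩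
  · rw [e1]
    exact hs1.add (hs6.mul_left _)
  · rw [e2]
    exact hs2.add (hs7.mul_left _)
  · rw [e3]
    exact hs1
  · rw [e4]
    exact hs2
  · rw [e5]
    exact hs3
  · rw [e6]
    exact hs5
  · rw [e7]
    exact hs4
  · have p1 : ∑ p ∈ posPairs (k + 1), riemannZeta (2 * p.1) * riemannZeta (2 * p.2) *
          (2 * (-1) ^ (k + 1) - 4 * (-1) ^ p.2 * (1 - 2 / 2 ^ (2 * p.1))) =
        ((2 * (-1) ^ (k + 1) * (∑ p ∈ posPairs (k + 1), signZeta 1 p.1 * signZeta 1 p.2) +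
          4 * ∑ p ∈ posPairs (k + 1), (-1) ^ p.2 * (signZeta (-1) p.1 * signZeta 1 p.2) : ℝ) : ℂ) := by
      rw [Finset.mul_sum, Finset.mul_sum, ← Finset.sum_add_distrib, Complex.ofReal_sum]
      refine Finset.sum_congr rfl fun p hp => ?_
      have hp' := mem_posPairs.mp hp
      rw [hz hp'.1, hz hp'.2.1, signZeta_neg_one hp'.1]
      push_cast
      ring
    have p2 : ∑ p ∈ posTriples (k + 1), (-1) ^ (p.1 + p.2.1) * (1 - 2 / 2 ^ (2 * p.2.2)) *
          riemannZeta (2 * p.1) * riemannZeta (2 * p.2.1) * riemannZeta (2 * p.2.2) =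
        ((-∑ p ∈ posTriples (k + 1), (-1) ^ (p.1 + p.2.1) *
          (signZeta 1 p.1 * signZeta 1 p.2.1 * signZeta (-1) p.2.2) : ℝ) : ℂ) := by
      rw [← Finset.sum_neg_distrib, Complex.ofReal_sum]
      refine Finset.sum_congr rfl fun p hp => ?_
      have hp' := mem_posTriples.mp hp
      rw [hz hp'.1, hz hp'.2.1, hz hp'.2.2.1, signZeta_neg_one hp'.2.2.1]
      push_cast
      ring
    -- All quantities are real, so the complex relation is the cast of a real one, where the linear
    -- arithmetic is done.
    have key : ∀ X S C z P T : ℝ, X + 2 * k * (-1) ^ k * S + (-1) ^ k * C + z * (1 - 1 / 2 ^ (2 * k + 1) - 2 * (-1) ^ (k + 1)) +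
        P + 4 * T = 0 →
        (X : ℂ) + 2 * k * (-1) ^ k * (S : ℂ) + (-1) ^ k * (C : ℂ) + (z : ℂ) * (1 - 1 / 2 ^ (2 * k + 1) - 2 * (-1) ^ (k + 1)) +
        (P : ℂ) + 4 * (T : ℂ) = 0 := by
      intro X S C z P T h
      have h' := congrArg (fun x : ℝ => (x : ℂ)) h
      push_cast at h'
      exact h'
    rw [p1, p2, hz1, e1, e5, e6, t1, c1]
    refine key _ _ _ _ _ _ ?_
    beta_reduce
    rw [hZ] at rn1
    rw [pow_succ (-1 : ℝ) k]
    linear_combination rn1 + hη1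
  · have p1 : ∑ p ∈ posPairs (k + 1),
          (-1) ^ p.2 * ((-1) ^ p.1 + 2) * altZeta (2 * p.1) * altZeta (2 * p.2) =
        (((-1) ^ (k + 1) * (∑ p ∈ posPairs (k + 1), signZeta (-1) p.1 * signZeta (-1) p.2) +
          2 * ∑ p ∈ posPairs (k + 1), (-1) ^ p.2 * (signZeta (-1) p.1 * signZeta (-1) p.2) :
          ℝ) : ℂ) := by
      rw [Finset.mul_sum, Finset.mul_sum, ← Finset.sum_add_distrib, Complex.ofReal_sum]
      refine Finset.sum_congr rfl fun p hp => ?_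
      rw [altZeta_two_mul, altZeta_two_mul, ← hpm p hp]
      push_cast
      ring
    have p2 : ∑ p ∈ posTriples (k + 1), (-1) ^ (p.1 + p.2.1) *
          altZeta (2 * p.1) * altZeta (2 * p.2.1) * altZeta (2 * p.2.2) =
        ((-∑ p ∈ posTriples (k + 1), (-1) ^ (p.1 + p.2.1) *
          (signZeta (-1) p.1 * signZeta (-1) p.2.1 * signZeta (-1) p.2.2) : ℝ) : ℂ) := by
      rw [← Finset.sum_neg_distrib, Complex.ofReal_sum]
      refine Finset.sum_congr rfl fun p hp => ?_
      rw [altZeta_two_mul, altZeta_two_mul, altZeta_two_mul]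
      push_cast
      ring
    have key : ∀ X S C z P T : ℝ, X + 2 * k * (-1) ^ k * S + (-1) ^ k * C +
        z * (1 - 1 / 2 ^ (2 * k + 1)) * (1 + 2 * (-1) ^ (k + 1)) + 2 * P + 4 * T = 0 →
        (X : ℂ) + 2 * k * (-1) ^ k * (S : ℂ) + (-1) ^ k * (C : ℂ) +
        (z : ℂ) * (1 - 1 / 2 ^ (2 * k + 1)) * (1 + 2 * (-1) ^ (k + 1)) + 2 * (P : ℂ) + 4 * (T : ℂ) = 0 := by
      intro X S C z P T h
      have h' := congrArg (fun x : ℝ => (x : ℂ)) h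
      push_cast at h'
      exact h'
    rw [p1, p2, hz1, e3, e5, e6, cn]
    refine key _ _ _ _ _ _ ?_
    beta_reduce
    rw [hZ, hZ'] at rnn
    rw [pow_succ (-1 : ℝ) k]
    -- The multiplier is the factor `1 + 2(-1)^(k+1)` that accompanies `ζ(2k+2)`.
    linear_combination rnn + (1 - 2 * (-1) ^ k) * hη1
  · have p1 : ∑ p ∈ posPairs (k + 1), (-1) ^ p.2 * ((1 - 2 / 2 ^ (2 * p.1)) * (-1) ^ p.1 - 2) *
          riemannZeta (2 * p.1) * altZeta (2 * p.2) =
        (((-1) ^ (k + 1) * (∑ p ∈ posPairs (k + 1), signZeta (-1) p.1 * signZeta (-1) p.2) +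
          2 * ∑ p ∈ posPairs (k + 1), (-1) ^ p.2 * (signZeta 1 p.1 * signZeta (-1) p.2) :
          ℝ) : ℂ) := by
      rw [Finset.mul_sum, Finset.mul_sum, ← Finset.sum_add_distrib, Complex.ofReal_sum]
      refine Finset.sum_congr rfl fun p hp => ?_
      have hp' := mem_posPairs.mp hp
      rw [altZeta_two_mul, hz hp'.1, ← hpm p hp, signZeta_neg_one hp'.1]
      push_cast
      ring
    have p2 : ∑ p ∈ posTriples (k + 1), (-1) ^ (p.1 + p.2.1) *
          altZeta (2 * p.1) * altZeta (2 * p.2.1) * riemannZeta (2 * p.2.2) =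
        ((∑ p ∈ posTriples (k + 1), (-1) ^ (p.1 + p.2.1) *
          (signZeta (-1) p.1 * signZeta (-1) p.2.1 * signZeta 1 p.2.2) : ℝ) : ℂ) := by
      rw [Complex.ofReal_sum]
      refine Finset.sum_congr rfl fun p hp => ?_
      rw [altZeta_two_mul, altZeta_two_mul, hz (mem_posTriples.mp hp).2.2.1]
      push_cast
      ring
    have key : ∀ X S z P T : ℝ, (1 + (-1) ^ k) * X + 2 * k * (-1) ^ k * S +
        z * (2 * (1 - 1 / 2 ^ (2 * k + 1)) * (-1) ^ (k + 1) - 1) + 2 * P - 4 * T = 0 →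
        (1 + (-1) ^ k) * (X : ℂ) + 2 * k * (-1) ^ k * (S : ℂ) +
        (z : ℂ) * (2 * (1 - 1 / 2 ^ (2 * k + 1)) * (-1) ^ (k + 1) - 1) + 2 * (P : ℂ) - 4 * (T : ℂ) = 0 := by
      intro X S z P T h
      have h' := congrArg (fun x : ℝ => (x : ℂ)) h
      push_cast at h'
      exact h'
    rw [p1, p2, hz1, e4, e7, cn]
    refine key _ _ _ _ _ ?_
    beta_reduce
    rw [hZ, hZ'] at r1n
    rw [pow_succ (-1 : ℝ) k]
    linear_combination r1n - 2 * (-1) ^ k * hη1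
  · have p1 : ∑ p ∈ posPairs (k + 1), ((-1) ^ (p.1 + p.2) + 2 * (-1) ^ p.2) *
          riemannZeta (2 * p.1) * riemannZeta (2 * p.2) =
        (((-1) ^ (k + 1) * (∑ p ∈ posPairs (k + 1), signZeta 1 p.1 * signZeta 1 p.2) +
          2 * ∑ p ∈ posPairs (k + 1), (-1) ^ p.2 * (signZeta 1 p.1 * signZeta 1 p.2) :
          ℝ) : ℂ) := by
      rw [Finset.mul_sum, Finset.mul_sum, ← Finset.sum_add_distrib, Complex.ofReal_sum]
      refine Finset.sum_congr rfl fun p hp => ?_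
      have hp' := mem_posPairs.mp hp
      rw [hz hp'.1, hz hp'.2.1, ← hpm p hp]
      push_cast
      ring
    have p2 : ∑ p ∈ posTriples (k + 1), (-1) ^ (p.1 + p.2.1) *
          riemannZeta (2 * p.1) * riemannZeta (2 * p.2.1) * riemannZeta (2 * p.2.2) =
        ((∑ p ∈ posTriples (k + 1), (-1) ^ (p.1 + p.2.1) *
          (signZeta 1 p.1 * signZeta 1 p.2.1 * signZeta 1 p.2.2) : ℝ) : ℂ) := by
      rw [Complex.ofReal_sum]
      refine Finset.sum_congr rfl fun p hp => ?_
      have hp' := mem_posTriples.mp hp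
      rw [hz hp'.1, hz hp'.2.1, hz hp'.2.2.1]
      push_cast
      ring
    have key : ∀ X S C z P T : ℝ, X + (-1) ^ k * C + 2 * k * (-1) ^ k * S + z * (2 * (-1) ^ k - 1) + 2 * P - 4 * T = 0 →
        (X : ℂ) + (-1) ^ k * (C : ℂ) + 2 * k * (-1) ^ k * (S : ℂ) + (z : ℂ) * (2 * (-1) ^ k - 1) + 2 * (P : ℂ) - 4 * (T : ℂ) = 0 := by
      intro X S C z P T h
      have h' := congrArg (fun x : ℝ => (x : ℂ)) h
      push_cast at h'
      exact h'
    rw [p1, p2, hz1, e2, e4, e7, t2, c1]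
    refine key _ _ _ _ _ _ ?_
    beta_reduce
    rw [hZ] at r11
    rw [pow_succ (-1 : ℝ) k]
    linear_combination r11
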